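/- Let $G=(V,E)$ be a finite connected graph with a (not necessarily proper) colouring $\omega:V\to C$ from a finite colour set $C$. The monochromatic component of a vertex $v$ is the set of vertices that can be reached from $v$ by a path in $G$ all of whose vertices have the same colour as $v$. A move $(v,d)\in V\times C$ gives colour $d$ to every vertex of the monochromatic component of $v$. For $U\subseteq V$ and $d\in C$, let $m_G(U,\omega,d)$ be the minimum length of a sequence of moves in $G$, started from $\omega$, after which some monochromatic component of colour $d$ contains $U$, and let $m_G(U,\omega)=\min_{d\in C}m_G(U,\omega,d)$. Running times are those of programs for a unit-cost random access machine (natural-number words, indirect addressing, addition and truncated subtraction, no multiplication). The input lists the colour set $C=\{0,\dots,|C|-1\}$, the colour of every vertex, the edges (each once, in any order and orientation), the elements of $U$ in any order, the sizes of these lists, and, in (1), the colour $d$. Theorem. (1) There are a single program and an absolute constant $K$ such that, for every connected graph $G=(V,E)$ of order $n$ with proper colouring $\omega$ from colour set $C$, every $U\subseteq V$ with $|U|=k$ and every $d\in C$, the program computes $m_G(U,\omega,d)$ in time at most $$K\left(n^{k+3}\cdot|E|\cdot|C|^2\cdot 2^k+1\right).$$ That is, the running time is $O(n^{k+3}\cdot|E|\cdot|C|^2\cdot2^k)$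 when $n\ge 2$, and $O(1)$ when $n=1$ (where $|E|=0$). (2) Consequently, for each fixed $k$, the problem $k$-Linking-Flood-It is solvable in polynomial time: for every $k$ there are a program and a polynomial $q$ such that, for every connected graph $G$ with an arbitrary (not necessarily proper) colouring $\omega$ from a finite colour set $C$ and every $U\subseteq V$ with $|U|\le k$, the program computes $m_G(U,\omega)$ in time at most $q(L)$, where $L$ is the number of words of the input. -/

import Mathlib

namespace FloodIt

section Game

variable {V C : Type*}

/-- The subgraph of `G` formed by the edges whose two ends have the same colour. -/
def monoGraph (G : SimpleGraph V) (ω : V → C) : SimpleGraph V where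
  Adj u v := G.Adj u v ∧ ω u = ω v
  symm := ⟨fun _ _ h => ⟨h.1.symm, h.2.symm⟩⟩
  loopless := ⟨fun _ h => G.irrefl h.1⟩

/-- The monochromatic component of `G`, with respect to the colouring `ω`, that contains `v`. -/
def monoComp (G : SimpleGraph V) (ω : V → C) (v : V) : Set V :=
  {u | (monoGraph G ω).Reachable v u}

open Classical in
/-- The move `(v, d)`: every vertex in the monochromatic component of `v` receives colour `d`. -/
noncomputable def playMove (G : SimpleGraph V) (ω : V → C) (m : V × C) : V → C :=
  fun u => if u ∈ monoComp G ω m.1 then m.2 else ω u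

/-- The colouring obtained from `ω` by playing the sequence of moves `S` in `G`. -/
noncomputable def play (G : SimpleGraph V) (ω : V → C) (S : List (V × C)) : V → C :=
  S.foldl (playMove G) ω

/-- Under `ω` there is a monochromatic component of colour `d` that contains every vertex of `U`. -/
def LinkedIn (G : SimpleGraph V) (ω : V → C) (U : Set V) (d : C) : Prop :=
  ∃ v, ω v = d ∧ U ⊆ monoComp G ω v

/-- `r` is the minimum number of moves that must be played in `G`, with initial colouring `ω`, to
create a monochromatic component of colour `d` containing `U`. -/
def IsLinkNumberIn (G : SimpleGraph V) (ω : V → C) (U : Set V) (d : C) (r : ℕ) : Prop :=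
  IsLeast {t : ℕ | ∃ S : List (V × C), S.length = t ∧ LinkedIn G (play G ω S) U d} r

/-- `r` is the minimum number of moves that must be played in `G`, with initial colouring `ω`, to
create a monochromatic component, of any colour, containing `U`. -/
def IsLinkNumber (G : SimpleGraph V) (ω : V → C) (U : Set V) (r : ℕ) : Prop :=
  IsLeast {t : ℕ | ∃ (d : C) (S : List (V × C)),
    S.length = t ∧ LinkedIn G (play G ω S) U d} r

end Game

section Machine

/-! Unit-cost random access programs: finitely many registers are used by any one program, the
memory is an array of natural numbers with indirect addressing, and the arithmetic is addition and
truncated subtraction. There is no multiplication, as is standard for the unit-cost measure. -/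

/-- A configuration of the memory: registers and addressable memory cells. -/
structure RamState where
  reg : ℕ → ℕ
  mem : ℕ → ℕ

/-- Expressions. `cell e` is the content of the memory cell whose address is the value of `e`. -/
inductive RamExpr : Type
  | num (a : ℕ) : RamExpr
  | reg (i : ℕ) : RamExpr
  | cell (e : RamExpr) : RamExpr
  | add (e f : RamExpr) : RamExpr
  | sub (e f : RamExpr) : RamExpr

/-- The value of an expression. -/
def RamExpr.eval (s : RamState) : RamExpr → ℕ
  | .num a => a
  | .reg i => s.reg i
  | .cell e => s.mem (e.eval s)
  | .add e f => e.eval s + f.eval s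
  | .sub e f => e.eval s - f.eval s

/-- The time needed to evaluate an expression: one unit for every node. -/
def RamExpr.cost : RamExpr → ℕ
  | .num _ => 1
  | .reg _ => 1
  | .cell e => e.cost + 1
  | .add e f => e.cost + f.cost + 1
  | .sub e f => e.cost + f.cost + 1

/-- Programs. A test succeeds when the value of its expression is non-zero. -/
inductive RamProg : Type
  | assign (i : ℕ) (e : RamExpr) : RamProg
  | store (a e : RamExpr) : RamProg
  | seq (p q : RamProg) : RamProg
  | ite (e : RamExpr) (p q : RamProg) : RamProg
  | loop (e : RamExpr) (p : RamProg) : RamProg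

/-- `RamExec p s t s'`: started in `s`, the program `p` halts after exactly `t` units of time, in
the configuration `s'`. -/
inductive RamExec : RamProg → RamState → ℕ → RamState → Prop
  | assign (i : ℕ) (e : RamExpr) (s : RamState) :
      RamExec (.assign i e) s (e.cost + 1) ⟨Function.update s.reg i (e.eval s), s.mem⟩
  | store (a e : RamExpr) (s : RamState) :
      RamExec (.store a e) s (a.cost + e.cost + 1)
        ⟨s.reg, Function.update s.mem (a.eval s) (e.eval s)⟩
  | seq {p q : RamProg} {s s' s'' : RamState} {t t' : ℕ}
      (hp : RamExec p s t s') (hq : RamExec q s' t' s'') :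
      RamExec (.seq p q) s (t + t') s''
  | iteTrue {e : RamExpr} {p q : RamProg} {s s' : RamState} {t : ℕ}
      (he : e.eval s ≠ 0) (hp : RamExec p s t s') :
      RamExec (.ite e p q) s (e.cost + 1 + t) s'
  | iteFalse {e : RamExpr} {p q : RamProg} {s s' : RamState} {t : ℕ}
      (he : e.eval s = 0) (hq : RamExec q s t s') :
      RamExec (.ite e p q) s (e.cost + 1 + t) s'
  | loopDone {e : RamExpr} {p : RamProg} {s : RamState} (he : e.eval s = 0) :
      RamExec (.loop e p) s (e.cost + 1) s
  | loopStep {e : RamExpr} {p : RamProg} {s s' s'' : RamState} {t t' : ℕ}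
      (he : e.eval s ≠ 0) (hp : RamExec p s t s') (hl : RamExec (.loop e p) s' t' s'') :
      RamExec (.loop e p) s (e.cost + 1 + t + t') s''

/-- The initial configuration: the input occupies the memory cells from address `0` on, and all
other cells and all registers hold `0`. -/
def ramInit (input : List ℕ) : RamState where
  reg := fun _ => 0
  mem := fun a => input.getD a 0

/-- On the given input the program `p` halts within `T` units of time with `r` in register `0`. -/
def RamComputesWithin (p : RamProg) (input : List ℕ) (r T : ℕ) : Prop :=
  ∃ (t : ℕ) (s : RamState), t ≤ T ∧ RamExec p (ramInit input) t s ∧ s.reg 0 = r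

end Machine

section Encoding

/-- The list `es` lists every edge of `G` exactly once, as a pair of its ends in some order. -/
def ListsEdges {n : ℕ} (G : SimpleGraph (Fin n)) (es : List (Fin n × Fin n)) : Prop :=
  (es.map (fun e => s(e.1, e.2))).Nodup ∧
    ∀ x : Sym2 (Fin n), x ∈ es.map (fun e => s(e.1, e.2)) ↔ x ∈ G.edgeSet

/-- The list `us` lists every element of `U` exactly once. -/
def ListsVertices {n : ℕ} (U : Finset (Fin n)) (us : List (Fin n)) : Prop :=
  us.Nodup ∧ ∀ x : Fin n, x ∈ us ↔ x ∈ U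

/-- The word sequence presented to a machine: the numbers of vertices, edges, colours and vertices
to be linked, followed by the colour set, the colours of the vertices, the edges, and the vertices
to be linked. -/
def instanceWords {n c : ℕ} (ω : Fin n → Fin c) (es : List (Fin n × Fin n))
    (us : List (Fin n)) : List ℕ :=
  [n, es.length, c, us.length] ++ List.range c ++ List.ofFn (fun v => (ω v : ℕ)) ++
    es.flatMap (fun e => [(e.1 : ℕ), (e.2 : ℕ)]) ++ us.map (fun u => (u : ℕ))

end Encoding

end FloodIt

namespace FloodIt

/-! ### The flooding game and its reduction to assembly trees. -/

section Game

variable {V C : Type*} {G : SimpleGraph V} {ω : V → C}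

/-! The order in which moves are played is irrelevant; what counts is a tree that records how a
component is put together. A `Build` starts from single vertices in their own colours, recolours a
set at cost 1, and joins two sets of equal colour along an edge at no cost. The least cost of an
assembled set of colour `d` containing `U` is the link number. An assembly of cost `r` is realised
by at most `r` moves (`Build.exists_play`). Conversely, charging each move to the vertex where it is
played lets every component after a play be assembled within its total charge, from pieces that are
distinct vertices (`exists_build_of_play`), so at most `n` pieces are ever needed.

Assembly costs obey a dynamic programme over tuples `t` of `k` vertices and colours `d`: either
recolour `t` from some `d'`, or split the positions of `t` into two parts and join across an edge
`xy`. Filling the vacated positions of the first part with `x` and those of the second with `y`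
keeps both tuples at length `k` and forces the ends of the edge into the two sets. There are `2 ^ k`
splits of each of the `n ^ k` tuples, hence a queue of `(2 * n) ^ k` marked tuples.

The table stores savings, that is `n` minus the cost. Recolouring every vertex shows that cost `n`
always suffices, so fresh zero memory is already a valid table; recolouring becomes truncated
subtraction of 1, and joining savings `v`, `w` gives `v + w - n`. Relaxation keeps every entry
attainable (`Sound`), and each round covers assemblies one step larger (`Complete.step`). Assemblies
of cost below `n` with at most `n` pieces are covered after `2 * n` rounds, so the table is then
exact (`optimal_of_table`). The remainder verifies a program doing this and counts its steps. -/

theorem mem_monoComp_self (v : V) : v ∈ monoComp G ω v :=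
  SimpleGraph.Reachable.refl v

theorem mem_monoComp_symm {u v : V} (h : u ∈ monoComp G ω v) : v ∈ monoComp G ω u :=
  SimpleGraph.Reachable.symm h

theorem monoComp_eq_of_mem {u v : V} (h : u ∈ monoComp G ω v) :
    monoComp G ω u = monoComp G ω v := by
  ext w
  exact ⟨fun hw => SimpleGraph.Reachable.trans h hw,
    fun hw => SimpleGraph.Reachable.trans (SimpleGraph.Reachable.symm h) hw⟩

theorem monoComp_induction {v : V} {p : V → Prop} (base : p v)
    (step : ∀ x y, x ∈ monoComp G ω v → p x → G.Adj x y → ω x = ω y → p y) {u : V}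
    (h : u ∈ monoComp G ω v) : p u := by
  have h' := (SimpleGraph.reachable_iff_reflTransGen v u).1 h
  induction h' with
  | refl => exact base
  | tail hab hbc ih =>
    have hb := (SimpleGraph.reachable_iff_reflTransGen _ _).2 hab
    exact step _ _ hb (ih hb) hbc.1 hbc.2

theorem colour_eq_of_mem_monoComp {u v : V} (h : u ∈ monoComp G ω v) : ω u = ω v :=
  monoComp_induction (p := fun x => ω x = ω v) rfl (fun _ _ _ hx _ he => he.symm.trans hx) h

theorem mem_monoComp_of_adj {x y v : V} (hx : x ∈ monoComp G ω v) (hxy : G.Adj x y)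
    (he : ω x = ω y) : y ∈ monoComp G ω v :=
  SimpleGraph.Reachable.trans hx (SimpleGraph.Adj.reachable (G := monoGraph G ω) ⟨hxy, he⟩)

theorem playMove_of_mem {v u : V} {d : C} (h : u ∈ monoComp G ω v) :
    playMove G ω (v, d) u = d := if_pos h

theorem playMove_of_not_mem {v u : V} {d : C} (h : u ∉ monoComp G ω v) :
    playMove G ω (v, d) u = ω u := if_neg h

/-- An edge with ends of equal colour lies entirely inside or entirely outside the recoloured
component, so its ends still agree after the move. -/
theorem monoComp_subset_playMove (v u : V) (d : C) :
    monoComp G ω u ⊆ monoComp G (playMove G ω (v, d)) u := by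
  intro w hw
  refine monoComp_induction (p := fun x => x ∈ monoComp G (playMove G ω (v, d)) u)
    (mem_monoComp_self u) ?_ hw
  intro x y _ hx' hxy he
  refine mem_monoComp_of_adj hx' hxy ?_
  by_cases hx : x ∈ monoComp G ω v
  · rw [playMove_of_mem hx, playMove_of_mem (mem_monoComp_of_adj hx hxy he)]
  · have hy : y ∉ monoComp G ω v := fun hy => hx (mem_monoComp_of_adj hy hxy.symm he.symm)
    rw [playMove_of_not_mem hx, playMove_of_not_mem hy, he]

/-- `Build G ω X d r N`: the set `X` can be assembled in colour `d` from `N` single vertices, by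
recolouring `r` times a set assembled before and by joining sets of the same colour along edges. -/
inductive Build (G : SimpleGraph V) (ω : V → C) : Set V → C → ℕ → ℕ → Prop
  | single (v : V) : Build G ω {v} (ω v) 0 1
  | recolour {X : Set V} {d : C} {r N : ℕ} (d' : C) (h : Build G ω X d r N) :
      Build G ω X d' (r + 1) N
  | join {X Y : Set V} {d : C} {r s N M : ℕ} {x y : V} (hX : Build G ω X d r N)
      (hY : Build G ω Y d s M) (hx : x ∈ X) (hy : y ∈ Y) (hxy : G.Adj x y) :
      Build G ω (X ∪ Y) d (r + s) (N + M)

/-- As `Build`, but assembled from whole monochromatic components. -/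
inductive CompBuild (G : SimpleGraph V) (ω : V → C) : Set V → C → ℕ → ℕ → Prop
  | single (v : V) : CompBuild G ω (monoComp G ω v) (ω v) 0 1
  | recolour {X : Set V} {d : C} {r N : ℕ} (d' : C) (h : CompBuild G ω X d r N) :
      CompBuild G ω X d' (r + 1) N
  | join {X Y : Set V} {d : C} {r s N M : ℕ} {x y : V} (hX : CompBuild G ω X d r N)
      (hY : CompBuild G ω Y d s M) (hx : x ∈ X) (hy : y ∈ Y) (hxy : G.Adj x y) :
      CompBuild G ω (X ∪ Y) d (r + s) (N + M)

theorem Build.compBuild {X : Set V} {d : C} {r N : ℕ} (h : Build G ω X d r N) :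
    ∃ X', X ⊆ X' ∧ CompBuild G ω X' d r N := by
  induction h with
  | single v =>
    exact ⟨_, Set.singleton_subset_iff.2 (mem_monoComp_self v), .single v⟩
  | recolour d' _ ih =>
    obtain ⟨X', hX, h'⟩ := ih
    exact ⟨X', hX, h'.recolour d'⟩
  | join _ _ hx hy hxy ih₁ ih₂ =>
    obtain ⟨X', hX, h₁⟩ := ih₁
    obtain ⟨Y', hY, h₂⟩ := ih₂
    exact ⟨X' ∪ Y', Set.union_subset_union hX hY, h₁.join h₂ (hX hx) (hY hy) hxy⟩

/-- The reason for passing from `Build` to `CompBuild`: a move recolours a whole component, and an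
assembled set that meets it must contain all of it. -/
theorem CompBuild.monoComp_subset {X : Set V} {d : C} {r N : ℕ} (h : CompBuild G ω X d r N)
    {u : V} (hu : u ∈ X) : monoComp G ω u ⊆ X := by
  induction h with
  | single v => exact (monoComp_eq_of_mem hu).subset
  | recolour d' _ ih => exact ih hu
  | join _ _ _ _ _ ih₁ ih₂ =>
    rcases hu with hu | hu
    · exact (ih₁ hu).trans Set.subset_union_left
    · exact (ih₂ hu).trans Set.subset_union_right

theorem CompBuild.pos {X : Set V} {d : C} {r N : ℕ} (h : CompBuild G ω X d r N) : 0 < N := by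
  induction h with
  | single v => exact Nat.one_pos
  | recolour d' _ ih => exact ih
  | join _ _ _ _ _ ih₁ ih₂ => omega

theorem Build.pos {X : Set V} {d : C} {r N : ℕ} (h : Build G ω X d r N) : 0 < N :=
  h.compBuild.choose_spec.2.pos

/-- A move that does not touch the assembled set does no harm. -/
theorem CompBuild.playMove_of_not_mem {X : Set V} {d : C} {r N : ℕ} (h : CompBuild G ω X d r N)
    {v : V} (hv : v ∉ X) (d₁ : C) :
    ∃ X', X ⊆ X' ∧ CompBuild G (playMove G ω (v, d₁)) X' d r N := by
  induction h with
  | single u =>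
    have hu : u ∉ monoComp G ω v := fun hu => hv (SimpleGraph.Reachable.symm hu)
    refine ⟨_, monoComp_subset_playMove v u d₁, ?_⟩
    have := CompBuild.single (G := G) (ω := playMove G ω (v, d₁)) u
    rwa [FloodIt.playMove_of_not_mem hu] at this
  | recolour d' _ ih =>
    obtain ⟨X', hX, h'⟩ := ih hv
    exact ⟨X', hX, h'.recolour d'⟩
  | join _ _ hx hy hxy ih₁ ih₂ =>
    obtain ⟨X', hX, h₁⟩ := ih₁ fun h => hv (Or.inl h)
    obtain ⟨Y', hY, h₂⟩ := ih₂ fun h => hv (Or.inr h)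
    exact ⟨X' ∪ Y', Set.union_subset_union hX hY, h₁.join h₂ (hX hx) (hY hy) hxy⟩

/-- The move `(v, d₁)` can be the first one: the assembly uses the recolouring of the component of
`v` with `d₁`, this component can be replaced there by any assembled set that contains it, and
either the move makes progress or there is an assembly with fewer pieces. -/
def Playable (G : SimpleGraph V) (ω : V → C) (X : Set V) (d : C) (r N : ℕ) (v : V) (d₁ : C) :
    Prop :=
  (∀ Z e s M, CompBuild G ω Z e s M → v ∈ Z →
    ∃ X' r' N', X ∪ Z ⊆ X' ∧ r' ≤ r + s ∧ N' + 1 ≤ N + M ∧ CompBuild G ω X' d r' N') ∧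
  ((∃ X' r' N', X ⊆ X' ∧ r' < r ∧ CompBuild G (playMove G ω (v, d₁)) X' d r' N') ∨
    ∃ X' r' N', X ⊆ X' ∧ r' ≤ r ∧ N' < N ∧ CompBuild G ω X' d r' N')

/-- If `v` is outside `Y`, the move does not disturb `Y` and the join is repeated after it. If `v`
is in `Y`, then `Y` would be spoilt by the move; instead it is plugged in at the recolouring of the
component of `v`, which makes the join superfluous and saves a piece. -/
theorem Playable.join {X Y : Set V} {d : C} {r s N M : ℕ} {v : V} {d₁ : C} {x y : V}
    (h : Playable G ω X d r N v d₁) (hY : CompBuild G ω Y d s M) (hx : x ∈ X) (hy : y ∈ Y)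
    (hxy : G.Adj x y) : Playable G ω (X ∪ Y) d (r + s) (N + M) v d₁ := by
  obtain ⟨hplug, hfire⟩ := h
  refine ⟨fun Z e t L hZ hv => ?_, ?_⟩
  · obtain ⟨X', r', N', hX', hr', hN', h'⟩ := hplug Z e t L hZ hv
    refine ⟨X' ∪ Y, r' + s, N' + M, ?_, by omega, by omega,
      h'.join hY (hX' (Or.inl hx)) hy hxy⟩
    rintro z ((hz | hz) | hz)
    · exact Or.inl (hX' (Or.inl hz))
    · exact Or.inr hz
    · exact Or.inl (hX' (Or.inr hz))
  · rcases hfire with ⟨X', r', N', hX', hr', h'⟩ | ⟨X', r', N', hX', hr', hN', h'⟩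
    · by_cases hv : v ∈ Y
      · obtain ⟨X'', r'', N'', hX'', hr'', hN'', h''⟩ := hplug Y d s M hY hv
        exact Or.inr ⟨X'', r'', N'', hX'', hr'', by omega, h''⟩
      · obtain ⟨Y', hYY, h₂⟩ := hY.playMove_of_not_mem hv d₁
        exact Or.inl ⟨X' ∪ Y', r' + s, N' + M, Set.union_subset_union hX' hYY, by omega,
          h'.join h₂ (hX' hx) (hYY hy) hxy⟩
    · exact Or.inr ⟨X' ∪ Y, r' + s, N' + M, Set.union_subset_union_left _ hX', by omega,
        by omega, h'.join hY (hX' hx) hy hxy⟩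

/-- The playable move is an innermost recolouring: one applied to a set that already lies inside a
single component. If there is none, joins of components of equal colour stay within one component.
-/
theorem CompBuild.linked_or_playable {X : Set V} {d : C} {r N : ℕ}
    (h : CompBuild G ω X d r N) :
    (∃ v, ω v = d ∧ X ⊆ monoComp G ω v) ∨ ∃ v d₁, Playable G ω X d r N v d₁ := by
  induction h with
  | single v => exact Or.inl ⟨v, rfl, Set.Subset.rfl⟩
  | @recolour X d r N d' h ih =>
    right
    rcases ih with ⟨v, hv, hX⟩ | ⟨v, d₁, hplug, hfire⟩
    · refine ⟨v, d', fun Z e s M hZ hvZ => ?_, Or.inl ?_⟩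
      -- `Z` contains the component of `v`, hence `X`; recolouring `Z` replaces the pieces of `X`,
      -- of which there is at least one.
      · have := h.pos
        exact ⟨Z, s + 1, M, Set.union_subset (hX.trans (hZ.monoComp_subset hvZ)) Set.Subset.rfl,
          by omega, by omega, hZ.recolour d'⟩
      -- After the move the enlarged component is itself one piece of colour `d'`, with no
      -- recolouring left.
      · refine ⟨_, 0, 1, hX.trans (monoComp_subset_playMove v v d'), Nat.succ_pos _, ?_⟩
        have := CompBuild.single (G := G) (ω := playMove G ω (v, d')) v
        rwa [playMove_of_mem (mem_monoComp_self v)] at this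
    · refine ⟨v, d₁, fun Z e s M hZ hvZ => ?_, ?_⟩
      · obtain ⟨X', r', N', hX', hr', hN', h'⟩ := hplug Z e s M hZ hvZ
        exact ⟨X', r' + 1, N', hX', by omega, hN', h'.recolour d'⟩
      · rcases hfire with ⟨X', r', N', hX', hr', h'⟩ | ⟨X', r', N', hX', hr', hN', h'⟩
        · exact Or.inl ⟨X', r' + 1, N', hX', by omega, h'.recolour d'⟩
        · exact Or.inr ⟨X', r' + 1, N', hX', by omega, hN', h'.recolour d'⟩
  | @join X Y d r s N M x y hX hY hx hy hxy ih₁ ih₂ =>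
    rcases ih₁ with ⟨v, hv, hXv⟩ | ⟨v, d₁, h₁⟩
    · rcases ih₂ with ⟨w, hw, hYw⟩ | ⟨w, d₁, h₂⟩
      · left
        refine ⟨v, hv, Set.union_subset hXv ?_⟩
        have hyv : y ∈ monoComp G ω v := mem_monoComp_of_adj (hXv hx) hxy (by
          rw [colour_eq_of_mem_monoComp (hXv hx), colour_eq_of_mem_monoComp (hYw hy), hv, hw])
        rwa [← monoComp_eq_of_mem hyv, monoComp_eq_of_mem (hYw hy)]
      · right
        have := h₂.join hX hy hx hxy.symm
        rw [Set.union_comm, Nat.add_comm r, Nat.add_comm N]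
        exact ⟨w, d₁, this⟩
    · exact Or.inr ⟨v, d₁, h₁.join hY hx hy hxy⟩

/-- Lexicographic induction on recolourings and then pieces: a playable move either lowers `r` at
the price of one move or yields an assembly with fewer pieces and no more recolourings. -/
theorem CompBuild.exists_play {X : Set V} {d : C} {r N : ℕ} (h : CompBuild G ω X d r N) :
    ∃ S : List (V × C), S.length ≤ r ∧ LinkedIn G (play G ω S) X d := by
  induction r using Nat.strong_induction_on generalizing ω X N with
  | _ r ihr =>
    induction N using Nat.strong_induction_on generalizing r X with
    | _ N ihN =>
      rcases h.linked_or_playable with ⟨v, hv, hX⟩ | ⟨v, d₁, -, hfire⟩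
      · exact ⟨[], Nat.zero_le _, v, hv, hX⟩
      · rcases hfire with ⟨X', r', N', hX', hr', h'⟩ | ⟨X', r', N', hX', hr', hN', h'⟩
        · obtain ⟨S, hS, w, hw, hXw⟩ := ihr r' hr' h'
          exact ⟨(v, d₁) :: S, by simp only [List.length_cons]; omega, w, hw, hX'.trans hXw⟩
        · rcases hr'.lt_or_eq with hlt | rfl
          · obtain ⟨S, hS, w, hw, hXw⟩ := ihr r' hlt h'
            exact ⟨S, by omega, w, hw, hX'.trans hXw⟩
          · obtain ⟨S, hS, w, hw, hXw⟩ := ihN N' hN' r' ihr h'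
            exact ⟨S, hS, w, hw, hX'.trans hXw⟩

theorem LinkedIn.mono {X Y : Set V} {d : C} (h : LinkedIn G ω Y d) (hXY : X ⊆ Y) :
    LinkedIn G ω X d := by
  obtain ⟨v, hv, hY⟩ := h
  exact ⟨v, hv, hXY.trans hY⟩

theorem Build.exists_play {X : Set V} {d : C} {r N : ℕ} (h : Build G ω X d r N) :
    ∃ S : List (V × C), S.length ≤ r ∧ LinkedIn G (play G ω S) X d := by
  obtain ⟨X', hX, h'⟩ := h.compBuild
  obtain ⟨S, hS, hl⟩ := h'.exists_play
  exact ⟨S, hS, hl.mono hX⟩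

/-- A monochromatic component of `ω'` that splits into assembled pieces can be assembled. -/
theorem Build.monoComp_of_pieces [DecidableEq V] {ω' : V → C} {v : V} {d : C} {a : V → ℕ}
    (P : V → Finset V) (hP : ∀ u ∈ monoComp G ω' v, u ∈ P u ∧ (P u : Set V) ⊆ monoComp G ω' v ∧
      Build G ω (P u : Set V) d (∑ x ∈ P u, a x) (P u).card ∧ ∀ w ∈ P u, P w = P u)
    {Y : Finset V} (hY : (Y : Set V) = monoComp G ω' v) :
    Build G ω (Y : Set V) d (∑ x ∈ Y, a x) Y.card := by
  -- Grow a union `Q` of pieces. A walk from `v` to a missing vertex leaves `Q` along some edge, and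
  -- the piece at its far end is disjoint from `Q`, so costs and cardinalities add.
  have key : ∀ m (Q : Finset V), (Y \ Q).card = m → Q ⊆ Y → v ∈ Q → (∀ u ∈ Q, P u ⊆ Q) →
      Build G ω (Q : Set V) d (∑ x ∈ Q, a x) Q.card →
      Build G ω (Y : Set V) d (∑ x ∈ Y, a x) Y.card := by
    intro m
    induction m using Nat.strong_induction_on with
    | _ m ih =>
      intro Q hm hQY hvQ hcl hQ
      by_cases hne : Q = Y
      · exact hne ▸ hQ
      obtain ⟨w, hwY, hwQ⟩ := Finset.exists_of_ssubset (hQY.ssubset_of_ne hne)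
      have hw : w ∈ monoComp G ω' v := hY ▸ Finset.mem_coe.2 hwY
      obtain ⟨p⟩ : (monoGraph G ω').Reachable v w := hw
      obtain ⟨e, -, heQ, heQ'⟩ := p.exists_boundary_dart (Q : Set V) hvQ hwQ
      have hx : e.fst ∈ Q := heQ
      have hy : e.snd ∉ Q := heQ'
      have hadj : (monoGraph G ω').Adj e.fst e.snd := e.adj
      have hyv : e.snd ∈ monoComp G ω' v :=
        mem_monoComp_of_adj (hY ▸ Finset.mem_coe.2 (hQY hx)) hadj.1 hadj.2
      obtain ⟨hyP, hPv, hPB, hPeq⟩ := hP _ hyv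
      have hPY : P e.snd ⊆ Y := by
        rw [← Finset.coe_subset, hY]; exact hPv
      have hdisj : Disjoint Q (P e.snd) := by
        rw [Finset.disjoint_left]
        intro z hzQ hzP
        exact hy (hcl z hzQ (hPeq z hzP ▸ hyP))
      have hB := hQ.join hPB hx hyP hadj.1
      rw [← Finset.coe_union, ← Finset.sum_union hdisj, ← Finset.card_union_of_disjoint hdisj]
        at hB
      refine ih (Y \ (Q ∪ P e.snd)).card ?_ _ rfl (Finset.union_subset hQY hPY)
        (Finset.mem_union_left _ hvQ) ?_ hB
      · rw [← hm]
        refine Finset.card_lt_card ⟨Finset.sdiff_subset_sdiff Finset.Subset.rfl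
          Finset.subset_union_left, fun h => ?_⟩
        have := h (Finset.mem_sdiff.2 ⟨hPY hyP, hy⟩)
        exact (Finset.mem_sdiff.1 this).2 (Finset.mem_union_right _ hyP)
      · intro u hu
        rcases Finset.mem_union.1 hu with hu | hu
        · exact (hcl u hu).trans Finset.subset_union_left
        · rw [hPeq u hu]; exact Finset.subset_union_right
  obtain ⟨hv, hPv, hB, hPeq⟩ := hP v (mem_monoComp_self v)
  refine key _ (P v) rfl ?_ hv (fun u hu => (hPeq u hu).subset) hB
  rw [← Finset.coe_subset, hY]; exact hPv

/-- After any play, the components can be assembled at a total cost of the number of moves. -/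
theorem exists_build_of_play [Fintype V] (S : List (V × C)) :
    ∃ a : V → ℕ, ∑ v, a v = S.length ∧ ∀ (v : V) (Y : Finset V),
      (Y : Set V) = monoComp G (play G ω S) v →
      Build G ω (Y : Set V) (play G ω S v) (∑ x ∈ Y, a x) Y.card := by
  classical
  induction S using List.reverseRecOn with
  | nil =>
    refine ⟨fun _ => 0, by simp, fun v Y hY => ?_⟩
    refine Build.monoComp_of_pieces (fun u => {u}) (fun u hu => ?_) hY
    have hu' : ω u = ω v := colour_eq_of_mem_monoComp hu
    refine ⟨by simp, by simpa using hu, ?_, fun w hw => by rw [Finset.mem_singleton.1 hw]⟩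
    have := Build.single (G := G) (ω := ω) u
    rw [hu'] at this
    simpa [play] using this
  | append_singleton S m ih =>
    obtain ⟨w, d⟩ := m
    obtain ⟨a, ha, hB⟩ := ih
    have hplay : play G ω (S ++ [(w, d)]) = playMove G (play G ω S) (w, d) := by
      simp [play]
    rw [hplay]
    set ω₀ := play G ω S with hω₀
    -- The new move is charged to `w`. Each new component is a union of old ones, and only the old
    -- component containing `w` pays for a recolouring.
    refine ⟨fun v => a v + if v = w then 1 else 0, ?_, fun v Y hY => ?_⟩
    · simp [Finset.sum_add_distrib, ha]
    · refine Build.monoComp_of_pieces (fun u => (monoComp G ω₀ u).toFinset) (fun u hu => ?_) hY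
      have hcol : playMove G ω₀ (w, d) u = playMove G ω₀ (w, d) v :=
        colour_eq_of_mem_monoComp hu
      refine ⟨by simpa using mem_monoComp_self u, ?_, ?_, fun z hz => ?_⟩
      · rw [Set.coe_toFinset, ← monoComp_eq_of_mem hu]
        exact monoComp_subset_playMove w u d
      · have h0 := hB u (monoComp G ω₀ u).toFinset (Set.coe_toFinset _)
        by_cases huw : u ∈ monoComp G ω₀ w
        · have hw : w ∈ (monoComp G ω₀ u).toFinset :=
            Set.mem_toFinset.2 (mem_monoComp_symm huw)
          rw [playMove_of_mem huw] at hcol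
          rw [Finset.sum_add_distrib, Finset.sum_ite_eq' _ w, if_pos hw, ← hcol]
          exact h0.recolour d
        · have hw : w ∉ (monoComp G ω₀ u).toFinset := fun h =>
            huw (mem_monoComp_symm (Set.mem_toFinset.1 h))
          rw [playMove_of_not_mem huw] at hcol
          rw [Finset.sum_add_distrib, Finset.sum_ite_eq' _ w, if_neg hw, ← hcol]
          exact h0
      · simp only [monoComp_eq_of_mem (Set.mem_toFinset.1 hz)]

theorem LinkedIn.exists_build [Fintype V] {S : List (V × C)} {U : Set V} {d : C}
    (h : LinkedIn G (play G ω S) U d) :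
    ∃ X r N, U ⊆ X ∧ r ≤ S.length ∧ N ≤ Fintype.card V ∧ Build G ω X d r N := by
  classical
  obtain ⟨v, rfl, hU⟩ := h
  obtain ⟨a, ha, hB⟩ := exists_build_of_play (G := G) (ω := ω) S
  refine ⟨_, _, _, hU, ?_, Finset.card_le_univ _, Set.coe_toFinset (monoComp G (play G ω S) v) ▸
    hB v (monoComp G (play G ω S) v).toFinset (Set.coe_toFinset _)⟩
  rw [← ha]
  exact Finset.sum_le_sum_of_subset (Finset.subset_univ _)

/-- Recolour each vertex once and join everything, the pieces being those of the constant colouring.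
This justifies the saving 0 for every tuple and colour. -/
theorem exists_build_univ [Fintype V] (hG : G.Connected) (d : C) :
    ∃ N, Build G ω Set.univ d (Fintype.card V) N := by
  classical
  obtain ⟨v⟩ := hG.nonempty
  have hY : ((Finset.univ : Finset V) : Set V) = monoComp G (fun _ => d) v := by
    ext u
    refine ⟨fun _ => (hG.preconnected v u).mono fun _ _ h => ⟨h, rfl⟩, fun _ => by simp⟩
  have := Build.monoComp_of_pieces (ω := ω) (d := d) (a := fun _ => 1) (fun u => {u})
    (fun u hu => ⟨by simp, by simpa using hu, by
      simpa using (Build.single (G := G) (ω := ω) u).recolour d, fun w hw => by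
        rw [Finset.mem_singleton.1 hw]⟩) hY
  exact ⟨_, by simpa using this⟩

end Game

/-! ### Timed Hoare rules for random access programs. -/

section RamLogic

/-- Started in `s`, the program `p` halts within `T` units of time in a state satisfying `Q`. -/
def Runs (p : RamProg) (s : RamState) (T : ℕ) (Q : RamState → Prop) : Prop :=
  ∃ t s', t ≤ T ∧ RamExec p s t s' ∧ Q s'

theorem Runs.mono {p : RamProg} {s : RamState} {T T' : ℕ} {Q Q' : RamState → Prop}
    (h : Runs p s T Q) (hT : T ≤ T') (hQ : ∀ s', Q s' → Q' s') : Runs p s T' Q' := by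
  obtain ⟨t, s', ht, he, hs⟩ := h
  exact ⟨t, s', ht.trans hT, he, hQ _ hs⟩

theorem Runs.seq {p q : RamProg} {s : RamState} {T₁ T₂ T : ℕ} {R Q : RamState → Prop}
    (hp : Runs p s T₁ R) (hq : ∀ s', R s' → Runs q s' T₂ Q) (hT : T₁ + T₂ ≤ T) :
    Runs (.seq p q) s T Q := by
  obtain ⟨t, s', ht, he, hs⟩ := hp
  obtain ⟨t', s'', ht', he', hs'⟩ := hq s' hs
  exact ⟨t + t', s'', by omega, .seq he he', hs'⟩

/-- The invariant is indexed by completed iterations and `N` is their exact number; the induction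
runs over the iterations that remain. -/
theorem Runs.loop {e : RamExpr} {p : RamProg} {s : RamState} {B N T : ℕ} {Q : RamState → Prop}
    (I : ℕ → RamState → Prop) (h0 : I 0 s)
    (hstep : ∀ j < N, ∀ s, I j s → e.eval s ≠ 0 ∧ Runs p s B (I (j + 1)))
    (hend : ∀ s, I N s → e.eval s = 0 ∧ Q s) (hT : N * (e.cost + 1 + B) + (e.cost + 1) ≤ T) :
    Runs (.loop e p) s T Q := by
  have key : ∀ m ≤ N, ∀ s, I (N - m) s →
      Runs (.loop e p) s (m * (e.cost + 1 + B) + (e.cost + 1)) Q := by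
    intro m
    induction m with
    | zero =>
      intro _ s hs
      obtain ⟨he, hQ⟩ := hend s hs
      exact ⟨_, s, by omega, .loopDone he, hQ⟩
    | succ m ih =>
      intro hm s hs
      obtain ⟨he, t, s', ht, hex, hs'⟩ := hstep _ (by omega) s hs
      rw [show N - (m + 1) + 1 = N - m by omega] at hs'
      obtain ⟨t', s'', ht', hex', hQ⟩ := ih (by omega) s' hs'
      refine ⟨_, s'', ?_, .loopStep he hex hex', hQ⟩
      rw [Nat.succ_mul]
      omega
  exact (key N le_rfl s (by simpa using h0)).mono hT fun _ h => h

/-- Programs without tests and loops. -/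
def RamProg.Straight : RamProg → Prop
  | .assign _ _ => True
  | .store _ _ => True
  | .seq p q => p.Straight ∧ q.Straight
  | .ite _ _ _ => False
  | .loop _ _ => False

/-- The effect of a program without tests and loops. -/
def RamProg.step : RamProg → RamState → RamState
  | .assign i e, s => ⟨Function.update s.reg i (e.eval s), s.mem⟩
  | .store a e, s => ⟨s.reg, Function.update s.mem (a.eval s) (e.eval s)⟩
  | .seq p q, s => q.step (p.step s)
  | .ite _ _ _, s => s
  | .loop _ _, s => s

/-- The running time of a program without tests and loops. -/
def RamProg.time : RamProg → ℕ
  | .assign _ e => e.cost + 1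
  | .store a e => a.cost + e.cost + 1
  | .seq p q => p.time + q.time
  | .ite _ _ _ => 0
  | .loop _ _ => 0

theorem RamProg.Straight.exec {p : RamProg} (hp : p.Straight) (s : RamState) :
    RamExec p s p.time (p.step s) := by
  induction p generalizing s with
  | assign i e => exact .assign i e s
  | store a e => exact .store a e s
  | seq p q ihp ihq => exact .seq (ihp hp.1 s) (ihq hp.2 _)
  | ite => exact hp.elim
  | loop => exact hp.elim

theorem Runs.straight {p : RamProg} {s : RamState} {T : ℕ} {Q : RamState → Prop}
    (hp : p.Straight) (hT : p.time ≤ T) (hQ : Q (p.step s)) : Runs p s T Q :=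
  ⟨_, _, hT, hp.exec s, hQ⟩

/-- Add the product of the registers `q` and `j` to register `r`, and clear register `q`. -/
def mulAdd (r q j : ℕ) : RamProg :=
  .loop (.reg q) (.seq (.assign r (.add (.reg r) (.reg j)))
    (.assign q (.sub (.reg q) (.num 1))))

/-- An iteration costs 2 for the test and 8 for the body. The time depends only on the multiplier in
`q`, so large codes may be multiplied by a vertex in time linear in `n`. -/
theorem mulAdd_runs {r q j : ℕ} (hrq : r ≠ q) (hrj : j ≠ r) (hqj : j ≠ q) (s : RamState)
    {T : ℕ} (hT : s.reg q * 10 + 2 ≤ T) :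
    Runs (mulAdd r q j) s T fun s' =>
      s' = ⟨Function.update (Function.update s.reg r (s.reg r + s.reg q * s.reg j)) q 0,
        s.mem⟩ := by
  refine Runs.loop (N := s.reg q) (B := 8) (fun i s' => i ≤ s.reg q ∧
    s' = ⟨Function.update (Function.update s.reg r (s.reg r + i * s.reg j)) q (s.reg q - i),
        s.mem⟩) ?_ ?_ ?_ ?_
  · refine ⟨Nat.zero_le _, ?_⟩
    simp
  · rintro i hi _ ⟨-, rfl⟩
    refine ⟨?_, .straight ⟨trivial, trivial⟩ le_rfl ⟨hi, ?_⟩⟩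
    · simp only [RamExpr.eval, Function.update_self]; omega
    · simp only [RamProg.step, RamExpr.eval, RamState.mk.injEq, and_true]
      funext x
      by_cases h1 : x = q
      · subst h1
        simp [hrq.symm]
        omega
      · by_cases h2 : x = r
        · subst h2
          simp [hrq, hrj, hqj]
          ring
        · simp [h1, h2]
  · rintro _ ⟨-, rfl⟩
    refine ⟨?_, ?_⟩
    · simp [RamExpr.eval]
    · simp
  · simp only [RamExpr.cost]; omega

end RamLogic

/-! ### Generating the queue of all marked tuples. -/

section Generation

/-! Registers: 1 the number of vertices, 2 of edges, 3 of colours, 4 of vertices to be linked;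
5, 6, 7 the addresses of the colours, of the edges and of the vertices to be linked; 8, 9 the two
ends of the current level of the queue; 10 the current place value, 11 the sum of the place values
so far, 12 the code of the vertices to be linked, 13 the level. -/

/-- The two entries of the next queue level that extend the entry at `h` by the vertex `v`, whose
digit contributes `vp`, are at `p`. -/
def Children (M M' : ℕ → ℕ) (h p vp pw : ℕ) : Prop :=
  M' p = M h + vp ∧ M' (p + 1) = M (h + 1) + vp ∧ M' (p + 2) = M (h + 2) + pw ∧
    M' (p + 3) = M h + vp ∧ M' (p + 4) = M (h + 1) ∧ M' (p + 5) = M (h + 2)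

def pushChildren : RamProg :=
  .seq (.store (.reg 9) (.add (.cell (.reg 8)) (.reg 15))) <|
  .seq (.store (.add (.reg 9) (.num 1)) (.add (.cell (.add (.reg 8) (.num 1))) (.reg 15))) <|
  .seq (.store (.add (.reg 9) (.num 2)) (.add (.cell (.add (.reg 8) (.num 2))) (.reg 10))) <|
  .seq (.store (.add (.reg 9) (.num 3)) (.add (.cell (.reg 8)) (.reg 15))) <|
  .seq (.store (.add (.reg 9) (.num 4)) (.cell (.add (.reg 8) (.num 1)))) <|
  .seq (.store (.add (.reg 9) (.num 5)) (.cell (.add (.reg 8) (.num 2)))) <|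
  .seq (.assign 9 (.add (.reg 9) (.num 6))) <|
  .seq (.assign 15 (.add (.reg 15) (.reg 10))) <|
  .assign 16 (.sub (.reg 16) (.num 1))

def expandEntry : RamProg :=
  .seq (.seq (.assign 15 (.num 0)) (.assign 16 (.reg 1))) <|
  .seq (.loop (.reg 16) pushChildren) <|
  .assign 8 (.add (.reg 8) (.num 3))

/-- The hypothesis separates the parent entry from the six cells written, so that the later stores
still read the parent unchanged. -/
theorem pushChildren_runs (s : RamState) (h : s.reg 8 + 3 ≤ s.reg 9) :
    Runs pushChildren s 100 fun s' =>
      (∀ i, i ≠ 9 → i ≠ 15 → i ≠ 16 → s'.reg i = s.reg i) ∧ s'.reg 9 = s.reg 9 + 6 ∧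
      s'.reg 15 = s.reg 15 + s.reg 10 ∧ s'.reg 16 = s.reg 16 - 1 ∧
      Children s.mem s'.mem (s.reg 8) (s.reg 9) (s.reg 15) (s.reg 10) ∧
      (∀ a < s.reg 9, s'.mem a = s.mem a) ∧ ∀ a, s.reg 9 + 6 ≤ a → s'.mem a = s.mem a := by
  refine .straight ⟨trivial, trivial, trivial, trivial, trivial, trivial, trivial, trivial,
    trivial⟩ (by decide) ?_
  simp only [pushChildren, RamProg.step, RamExpr.eval]
  have e0 : s.reg 8 ≠ s.reg 9 := by omega
  refine ⟨fun i h1 h2 h3 => ?_, by simp, by simp, by simp, ?_, fun a ha => ?_, fun a ha => ?_⟩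
  · simp [h1, h2, h3]
  · refine ⟨?_, ?_, ?_, ?_, ?_, ?_⟩ <;>
      simp only [Function.update_apply] <;> grind
  · simp only [Function.update_apply]
    grind
  · simp only [Function.update_apply]
    grind

theorem expandEntry_runs (s : RamState) (h : s.reg 8 + 3 ≤ s.reg 9) :
    Runs expandEntry s (s.reg 1 * 102 + 20) fun s' =>
      (∀ i, i ≠ 8 → i ≠ 9 → i ≠ 15 → i ≠ 16 → s'.reg i = s.reg i) ∧
      s'.reg 8 = s.reg 8 + 3 ∧ s'.reg 9 = s.reg 9 + 6 * s.reg 1 ∧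
      (∀ v < s.reg 1, Children s.mem s'.mem (s.reg 8) (s.reg 9 + 6 * v) (v * s.reg 10)
        (s.reg 10)) ∧
      (∀ a < s.reg 9, s'.mem a = s.mem a) ∧
      ∀ a, s.reg 9 + 6 * s.reg 1 ≤ a → s'.mem a = s.mem a := by
  refine Runs.seq (T₁ := 4) (R := fun s' => s'.mem = s.mem ∧ s'.reg 15 = 0 ∧
    s'.reg 16 = s.reg 1 ∧ ∀ i, i ≠ 15 → i ≠ 16 → s'.reg i = s.reg i)
    (.straight ⟨trivial, trivial⟩ (by decide) ?_) ?_ (T₂ := s.reg 1 * 102 + 16) (by omega)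
  · refine ⟨rfl, by simp [RamProg.step, RamExpr.eval], by simp [RamProg.step, RamExpr.eval],
      fun i h1 h2 => by simp [RamProg.step, h1, h2]⟩
  rintro s₁ ⟨hm₁, h15, h16, hfr⟩
  refine Runs.seq (T₁ := s.reg 1 * 102 + 2) (R := fun s' =>
      (∀ i, i ≠ 9 → i ≠ 15 → i ≠ 16 → s'.reg i = s.reg i) ∧
      s'.reg 9 = s.reg 9 + 6 * s.reg 1 ∧
      (∀ v < s.reg 1, Children s.mem s'.mem (s.reg 8) (s.reg 9 + 6 * v) (v * s.reg 10)
        (s.reg 10)) ∧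
      (∀ a < s.reg 9, s'.mem a = s.mem a) ∧
      ∀ a, s.reg 9 + 6 * s.reg 1 ≤ a → s'.mem a = s.mem a) ?_ ?_ (T₂ := 4) (by omega)
  · refine Runs.loop (N := s.reg 1) (B := 100) (fun j s' =>
      (∀ i, i ≠ 9 → i ≠ 15 → i ≠ 16 → s'.reg i = s.reg i) ∧
      s'.reg 9 = s.reg 9 + 6 * j ∧ s'.reg 15 = j * s.reg 10 ∧ s'.reg 16 = s.reg 1 - j ∧
      (∀ v < j, Children s.mem s'.mem (s.reg 8) (s.reg 9 + 6 * v) (v * s.reg 10)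
        (s.reg 10)) ∧
      (∀ a < s.reg 9, s'.mem a = s.mem a) ∧
      ∀ a, s.reg 9 + 6 * j ≤ a → s'.mem a = s.mem a) ?_ ?_ ?_ ?_
    · exact ⟨fun i _ h2 h3 => hfr i h2 h3, by simp [hfr], by simp [h15], by simp [h16],
        fun v hv => absurd hv (Nat.not_lt_zero _), fun a _ => by rw [hm₁], fun a _ => by rw [hm₁]⟩
    · rintro j hj s₂ ⟨hf, h9, h15, h16, hch, hlo, hhi⟩
      have h8 : s₂.reg 8 = s.reg 8 := hf 8 (by decide) (by decide) (by decide)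
      have h10 : s₂.reg 10 = s.reg 10 := hf 10 (by decide) (by decide) (by decide)
      refine ⟨by simp only [RamExpr.eval]; omega, (pushChildren_runs s₂ (by omega)).mono le_rfl ?_⟩
      rintro s₃ ⟨hf', h9', h15', h16', hch', hlo', hhi'⟩
      refine ⟨fun i h1 h2 h3 => (hf' i h1 h2 h3).trans (hf i h1 h2 h3), by omega, ?_, by omega,
        fun v hv => ?_, fun a ha => (hlo' a (by omega)).trans (hlo a ha), fun a ha =>
        (hhi' a (by omega)).trans (hhi a (by omega))⟩
      · rw [h15', h15, h10]; ring
      · rcases Nat.lt_succ_iff_lt_or_eq.1 hv with hv | rfl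
        · obtain ⟨c0, c1, c2, c3, c4, c5⟩ := hch v hv
          exact ⟨(hlo' _ (by omega)).trans c0, (hlo' _ (by omega)).trans c1,
            (hlo' _ (by omega)).trans c2, (hlo' _ (by omega)).trans c3,
            (hlo' _ (by omega)).trans c4, (hlo' _ (by omega)).trans c5⟩
        · rw [h8, h9, h15, h10] at hch'
          obtain ⟨c0, c1, c2, c3, c4, c5⟩ := hch'
          rw [hlo _ (by omega)] at c0 c1 c2 c3 c4 c5
          exact ⟨c0, c1, c2, c3, c4, c5⟩
    · rintro s₂ ⟨hf, h9, h15, h16, hch, hlo, hhi⟩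
      exact ⟨by simp only [RamExpr.eval]; omega, hf, h9, hch, hlo, hhi⟩
    · simp only [RamExpr.cost]; omega
  · rintro s₂ ⟨hf, h9, hch, hlo, hhi⟩
    refine .straight trivial (by decide) ?_
    refine ⟨fun i h1 h2 h3 h4 => ?_, ?_, ?_, hch, hlo, hhi⟩
    · simp [RamProg.step, h1, hf i h2 h3 h4]
    · simp [RamProg.step, RamExpr.eval, hf]
    · simp [RamProg.step, h9]

/-- Replace every entry of the current level of the queue by its children. -/
def expandLevel : RamProg :=
  .seq (.assign 14 (.reg 9)) (.loop (.sub (.reg 14) (.reg 8)) expandEntry)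

/-- Register 14 freezes the old tail, since register 9 advances while children are appended. Each
parent owns a block of `6 * n` words, two entries of three words for every vertex. -/
theorem expandLevel_runs (s : RamState) {N : ℕ} (h : s.reg 9 = s.reg 8 + 3 * N) :
    Runs expandLevel s (N * (s.reg 1 * 102 + 24) + 6) fun s' =>
      (∀ i, i ≠ 8 → i ≠ 9 → i ≠ 14 → i ≠ 15 → i ≠ 16 → s'.reg i = s.reg i) ∧
      s'.reg 8 = s.reg 9 ∧ s'.reg 9 = s.reg 9 + 6 * (s.reg 1 * N) ∧
      (∀ q < N, ∀ v < s.reg 1, Children s.mem s'.mem (s.reg 8 + 3 * q)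
        (s.reg 9 + 6 * (s.reg 1 * q + v)) (v * s.reg 10) (s.reg 10)) ∧
      (∀ a < s.reg 9, s'.mem a = s.mem a) ∧
      ∀ a, s.reg 9 + 6 * (s.reg 1 * N) ≤ a → s'.mem a = s.mem a := by
  refine Runs.seq (T₁ := 2) (R := fun s' => s' = ⟨Function.update s.reg 14 (s.reg 9), s.mem⟩)
    (.straight trivial (by decide) rfl) ?_ (T₂ := N * (s.reg 1 * 102 + 24) + 4) (by omega)
  rintro _ rfl
  refine Runs.loop (N := N) (B := s.reg 1 * 102 + 20) (fun j s' =>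
      (∀ i, i ≠ 8 → i ≠ 9 → i ≠ 14 → i ≠ 15 → i ≠ 16 → s'.reg i = s.reg i) ∧
      s'.reg 14 = s.reg 9 ∧
      s'.reg 8 = s.reg 8 + 3 * j ∧ s'.reg 9 = s.reg 9 + 6 * (s.reg 1 * j) ∧
      (∀ q < j, ∀ v < s.reg 1, Children s.mem s'.mem (s.reg 8 + 3 * q)
        (s.reg 9 + 6 * (s.reg 1 * q + v)) (v * s.reg 10) (s.reg 10)) ∧
      (∀ a < s.reg 9, s'.mem a = s.mem a) ∧
      ∀ a, s.reg 9 + 6 * (s.reg 1 * j) ≤ a → s'.mem a = s.mem a) ?_ ?_ ?_ ?_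
  · refine ⟨fun i _ _ h3 _ _ => by simp [h3], by simp, by simp, by simp, fun v hv =>
      absurd hv (Nat.not_lt_zero _), fun a _ => rfl, fun a _ => rfl⟩
  · rintro j hj s₂ ⟨hf, h14, h8, h9, hch, hlo, hhi⟩
    have h1 : s₂.reg 1 = s.reg 1 := hf 1 (by decide) (by decide) (by decide) (by decide)
      (by decide)
    have h10 : s₂.reg 10 = s.reg 10 := hf 10 (by decide) (by decide) (by decide) (by decide)
      (by decide)
    refine ⟨by simp only [RamExpr.eval]; omega,
      (expandEntry_runs s₂ (by omega)).mono (by rw [h1]) ?_⟩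
    rintro s₃ ⟨hf', h8', h9', hch', hlo', hhi'⟩
    rw [h1] at h9' hch' hhi'
    have hmul : s.reg 1 * (j + 1) = s.reg 1 * j + s.reg 1 := Nat.mul_succ _ _
    refine ⟨fun i g1 g2 g3 g4 g5 => (hf' i g1 g2 g4 g5).trans (hf i g1 g2 g3 g4 g5),
      (hf' 14 (by decide) (by decide) (by decide) (by decide)).trans h14, by omega, by omega,
      fun q hq v hv => ?_, fun a ha => (hlo' a (by omega)).trans (hlo a ha), fun a ha =>
      (hhi' a (by omega)).trans (hhi a (by omega))⟩
    rcases Nat.lt_succ_iff_lt_or_eq.1 hq with hq | rfl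
    · obtain ⟨c0, c1, c2, c3, c4, c5⟩ := hch q hq v hv
      have : s.reg 1 * q + s.reg 1 ≤ s.reg 1 * j := by
        rw [← Nat.mul_succ]; exact Nat.mul_le_mul_left _ hq
      exact ⟨(hlo' _ (by omega)).trans c0, (hlo' _ (by omega)).trans c1,
        (hlo' _ (by omega)).trans c2, (hlo' _ (by omega)).trans c3,
        (hlo' _ (by omega)).trans c4, (hlo' _ (by omega)).trans c5⟩
    · obtain ⟨c0, c1, c2, c3, c4, c5⟩ := hch' v hv
      rw [h8, hlo _ (by omega)] at c0 c1 c2 c3 c4 c5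
      rw [h10] at c0 c1 c2 c3
      rw [h9, show s.reg 9 + 6 * (s.reg 1 * q) + 6 * v = s.reg 9 + 6 * (s.reg 1 * q + v) by ring]
        at c0 c1 c2 c3 c4 c5
      exact ⟨c0, c1, c2, c3, c4, c5⟩
  · rintro s₂ ⟨hf, h14, h8, h9, hch, hlo, hhi⟩
    exact ⟨by simp only [RamExpr.eval]; omega, hf, by omega, h9, hch, hlo, hhi⟩
  · simp only [RamExpr.cost]
    rw [show s.reg 1 * 102 + 24 = 1 + 1 + 1 + 1 + (s.reg 1 * 102 + 20) by omega]

/-- The number with base-`n` digits `f` of the elements of `σ`, in units of `c`. -/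
def code {α : Type*} (n c : ℕ) (f : α → ℕ) (σ : List α) : ℕ :=
  c * Nat.ofDigits n (σ.map f)

theorem code_concat {α : Type*} (n c : ℕ) (f : α → ℕ) (σ : List α) (x : α) :
    code n c f (σ ++ [x]) = code n c f σ + f x * (c * n ^ σ.length) := by
  simp only [code, List.map_append, Nat.ofDigits_append, List.map_cons, List.map_nil,
    Nat.ofDigits_singleton, List.length_map]
  ring

/-- The address `h` holds the entry for `σ`, a tuple of vertices of which some are marked: the
codes of the tuple, of its marked part and of the set of marked positions. -/
def IsEntry {n : ℕ} (c : ℕ) (M : ℕ → ℕ) (h : ℕ) (σ : List (Fin n × Bool)) : Prop :=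
  M h = code n c (fun p => (p.1 : ℕ)) σ ∧
    M (h + 1) = code n c (fun p => if p.2 then (p.1 : ℕ) else 0) σ ∧
    M (h + 2) = code n c (fun p => if p.2 then 1 else 0) σ

/-- From address `h` on there are the entries for all marked tuples of length `j`. -/
def IsLevel (n c : ℕ) (M : ℕ → ℕ) (h j : ℕ) : Prop :=
  (∀ q < (2 * n) ^ j, ∃ σ : List (Fin n × Bool), σ.length = j ∧ IsEntry c M (h + 3 * q) σ) ∧
    ∀ σ : List (Fin n × Bool), σ.length = j → ∃ q < (2 * n) ^ j, IsEntry c M (h + 3 * q) σ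

theorem Children.isEntry {n c : ℕ} {M M' : ℕ → ℕ} {h p : ℕ} {v : Fin n}
    {σ : List (Fin n × Bool)}
    (hch : Children M M' h p (v * (c * n ^ σ.length)) (c * n ^ σ.length))
    (hσ : IsEntry c M h σ) (b : Bool) :
    IsEntry c M' (p + 3 * (if b then 0 else 1)) (σ ++ [(v, b)]) := by
  obtain ⟨c0, c1, c2, c3, c4, c5⟩ := hch
  obtain ⟨e0, e1, e2⟩ := hσ
  simp only [IsEntry, code_concat, ← e0, ← e1, ← e2]
  cases b
  · simp [c3, c4, c5]
  · simp [c0, c1, c2]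

theorem IsLevel.succ {n c : ℕ} {M M' : ℕ → ℕ} {h h' j : ℕ} (hn : 0 < n) (hM : IsLevel n c M h j)
    (hch : ∀ q < (2 * n) ^ j, ∀ v < n, Children M M' (h + 3 * q) (h' + 6 * (n * q + v))
      (v * (c * n ^ j)) (c * n ^ j)) : IsLevel n c M' h' (j + 1) := by
  have hpow : (2 * n) ^ (j + 1) = 2 * (n * (2 * n) ^ j) := by ring
  constructor
  · intro q hq
    -- A slot decodes as follows: parity gives the mark (even means marked), `q / 2` modulo `n` the
    -- new vertex, and the quotient the parent.
    have hq2 : q / 2 < n * (2 * n) ^ j := by omega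
    have hq3 : q / 2 / n < (2 * n) ^ j := Nat.div_lt_of_lt_mul hq2
    obtain ⟨σ, rfl, hσ⟩ := hM.1 _ hq3
    have := (hch _ hq3 _ (Nat.mod_lt (q / 2) hn)).isEntry (v := ⟨_, Nat.mod_lt (q / 2) hn⟩) hσ
      (q % 2 = 0)
    rw [Nat.div_add_mod] at this
    refine ⟨σ ++ [((⟨_, Nat.mod_lt (q / 2) hn⟩ : Fin n), decide (q % 2 = 0))], by simp, ?_⟩
    convert this using 1
    rcases Nat.mod_two_eq_zero_or_one q with h0 | h0 <;> simp [h0] <;> omega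
  · intro τ hτ
    obtain ⟨σ, ⟨v, b⟩, rfl⟩ : ∃ σ x, τ = σ ++ [x] := by
      rcases List.eq_nil_or_concat τ with h0 | ⟨σ, x, h0⟩
      · simp [h0] at hτ
      · exact ⟨σ, x, by simpa using h0⟩
    obtain rfl : σ.length = j := by simpa using hτ
    obtain ⟨q, hq, hσ⟩ := hM.2 σ rfl
    refine ⟨2 * (n * q + v) + (if b then 0 else 1), ?_, ?_⟩
    · have : n * q + n ≤ n * (2 * n) ^ σ.length := by
        rw [← Nat.mul_succ]; exact Nat.mul_le_mul_left _ hq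
      have := v.isLt
      split <;> omega
    · have := (hch q hq v v.isLt).isEntry hσ b
      rwa [show h' + 6 * (n * q + v) + 3 * (if b then 0 else 1) =
        h' + 3 * (2 * (n * q + v) + (if b then 0 else 1)) by ring] at this

/-- One step of the generation of the queue. -/
def nextLevel : RamProg :=
  .seq (.assign 18 (.cell (.add (.reg 7) (.reg 13)))) <|
  .seq (mulAdd 12 18 10) <|
  .seq (.assign 11 (.add (.reg 11) (.reg 10))) <|
  .seq expandLevel <|
  .seq (.seq (.assign 15 (.num 0)) (.assign 18 (.reg 1))) <|
  .seq (mulAdd 15 18 10) <|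
  .seq (.assign 10 (.reg 15)) (.assign 13 (.add (.reg 13) (.num 1)))

theorem nextLevel_runs (s : RamState) {N : ℕ} (h : s.reg 9 = s.reg 8 + 3 * N)
    (hx : s.mem (s.reg 7 + s.reg 13) ≤ s.reg 1) :
    Runs nextLevel s (N * (s.reg 1 * 102 + 24) + s.reg 1 * 20 + 40) fun s' =>
      (∀ i < 8, s'.reg i = s.reg i) ∧
      s'.reg 8 = s.reg 9 ∧ s'.reg 9 = s.reg 9 + 6 * (s.reg 1 * N) ∧
      s'.reg 10 = s.reg 1 * s.reg 10 ∧ s'.reg 11 = s.reg 11 + s.reg 10 ∧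
      s'.reg 12 = s.reg 12 + s.mem (s.reg 7 + s.reg 13) * s.reg 10 ∧
      s'.reg 13 = s.reg 13 + 1 ∧
      (∀ q < N, ∀ v < s.reg 1, Children s.mem s'.mem (s.reg 8 + 3 * q)
        (s.reg 9 + 6 * (s.reg 1 * q + v)) (v * s.reg 10) (s.reg 10)) ∧
      (∀ a < s.reg 9, s'.mem a = s.mem a) ∧
      ∀ a, s.reg 9 + 6 * (s.reg 1 * N) ≤ a → s'.mem a = s.mem a := by
  unfold nextLevel
  refine Runs.seq (.straight trivial (le_refl 5) rfl)
    (T₂ := N * (s.reg 1 * 102 + 24) + s.reg 1 * 20 + 34) ?_ (by omega)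
  rintro _ rfl
  refine Runs.seq (mulAdd_runs (by decide) (by decide) (by decide) _ le_rfl)
    (T₂ := N * (s.reg 1 * 102 + 24) + s.reg 1 * 10 + 28) ?_
    (by simp [RamProg.step, RamExpr.eval]; omega)
  rintro _ rfl
  refine Runs.seq (.straight trivial (le_refl 4) rfl)
    (T₂ := N * (s.reg 1 * 102 + 24) + s.reg 1 * 10 + 24) ?_ (by omega)
  rintro _ rfl
  refine Runs.seq (expandLevel_runs (N := N) _ ?_)
    (T₂ := s.reg 1 * 10 + 18) ?_ ?_
  · simp [RamProg.step, RamExpr.eval, h]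
  swap
  · simp [RamProg.step, RamExpr.eval]; omega
  rintro s₁ ⟨hf, h8, h9, hch, hlo, hhi⟩
  simp [RamProg.step, RamExpr.eval] at h8 h9 hch hlo hhi
  have hf' : ∀ i, i < 8 → s₁.reg i = s.reg i := fun i hi => by
    rw [hf i (by omega) (by omega) (by omega) (by omega) (by omega)]
    simp [RamProg.step, show i ≠ 11 by omega, show i ≠ 12 by omega, show i ≠ 18 by omega]
  have h10 : s₁.reg 10 = s.reg 10 := by
    rw [hf 10 (by decide) (by decide) (by decide) (by decide) (by decide)]
    simp [RamProg.step]
  have h11 : s₁.reg 11 = s.reg 11 + s.reg 10 := by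
    rw [hf 11 (by decide) (by decide) (by decide) (by decide) (by decide)]
    simp [RamProg.step, RamExpr.eval]
  have h12 : s₁.reg 12 = s.reg 12 + s.mem (s.reg 7 + s.reg 13) * s.reg 10 := by
    rw [hf 12 (by decide) (by decide) (by decide) (by decide) (by decide)]
    simp [RamProg.step, RamExpr.eval]
  have h13 : s₁.reg 13 = s.reg 13 := by
    rw [hf 13 (by decide) (by decide) (by decide) (by decide) (by decide)]
    simp [RamProg.step]
  clear hf
  refine Runs.seq (.straight ⟨trivial, trivial⟩ (le_refl 4) rfl)
    (T₂ := s.reg 1 * 10 + 8) ?_ (by omega)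
  rintro _ rfl
  refine Runs.seq (mulAdd_runs (by decide) (by decide) (by decide) _ le_rfl)
    (T₂ := 6) ?_ (by simp [RamProg.step, RamExpr.eval, hf'])
  rintro _ rfl
  refine .straight ⟨trivial, trivial⟩ (by decide) ?_
  refine ⟨fun i hi => ?_, ?_, ?_, ?_, ?_, ?_, ?_, hch, hlo, hhi⟩
  · simp [RamProg.step, show i ≠ 10 by omega, show i ≠ 13 by omega, show i ≠ 15 by omega,
      show i ≠ 18 by omega, hf' i hi]
  all_goals simp [RamProg.step, RamExpr.eval, h8, h9, h10, h11, h12, h13, hf']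

/-- Generate the queue. -/
def generate : RamProg :=
  .loop (.sub (.reg 4) (.reg 13)) nextLevel

/-- The state of the machine when `j` levels of the queue have been generated. -/
structure Generated (n c : ℕ) (us : List (Fin n)) (s₀ : RamState) (j : ℕ) (s : RamState) :
    Prop where
  reg : ∀ i < 8, s.reg i = s₀.reg i
  place : s.reg 10 = c * n ^ j
  ones : s.reg 11 = code n c (fun _ => 1) (us.take j)
  target : s.reg 12 = code n c (fun u : Fin n => (u : ℕ)) (us.take j)
  level : s.reg 13 = j
  tail : s.reg 9 = s.reg 8 + 3 * (2 * n) ^ j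
  head : s₀.reg 8 ≤ s.reg 8
  low : ∀ a < s₀.reg 8, s.mem a = s₀.mem a
  high : ∀ a, s.reg 9 ≤ a → s.mem a = 0
  queue : IsLevel n c s.mem (s.reg 8) j

theorem generate_runs {n c : ℕ} (hn : 0 < n) {us : List (Fin n)} {s : RamState}
    (h1 : s.reg 1 = n) (h4 : s.reg 4 = us.length) (h7 : s.reg 7 + us.length ≤ s.reg 8)
    (hus : ∀ j (h : j < us.length), s.mem (s.reg 7 + j) = us[j])
    (h0 : Generated n c us s 0 s) :
    Runs generate s
      (us.length * ((2 * n) ^ us.length * (n * 102 + 24) + n * 20 + 44) + 4)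
      (Generated n c us s us.length) := by
  refine Runs.loop (N := us.length) (B := (2 * n) ^ us.length * (n * 102 + 24) + n * 20 + 40)
    (Generated n c us s) h0 ?_ ?_ ?_
  · intro j hj s' h
    have e1 : s'.reg 1 = n := (h.reg 1 (by decide)).trans h1
    have e4 : s'.reg 4 = us.length := (h.reg 4 (by decide)).trans h4
    have e7 : s'.reg 7 = s.reg 7 := h.reg 7 (by decide)
    have hx : s'.mem (s'.reg 7 + s'.reg 13) = us[j] := by
      rw [e7, h.level, h.low _ (by omega), hus j hj]
    have hlen : (us.take j).length = j := by simp; omega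
    have htake : us.take (j + 1) = us.take j ++ [us[j]] := List.take_succ_eq_append_getElem hj
    refine ⟨by simp only [RamExpr.eval, e4, h.level]; omega,
      (nextLevel_runs s' h.tail ?_).mono ?_ ?_⟩
    · rw [hx, e1]; exact us[j].isLt.le
    · rw [e1]
      -- Every level is charged as much as the last one; the resulting factor `k ≤ n` is affordable.
      have : (2 * n) ^ j ≤ (2 * n) ^ us.length := Nat.pow_le_pow_right (by omega) hj.le
      have := Nat.mul_le_mul_right (n * 102 + 24) this
      omega
    · rintro s'' ⟨hf, h8', h9', h10', h11', h12', h13', hch, hlo, hhi⟩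
      rw [hx, h.place] at h12'
      rw [e1, h.place] at hch h10'
      rw [e1] at h9' hhi
      refine ⟨fun i hi => (hf i hi).trans (h.reg i hi), ?_, ?_, ?_, ?_, ?_, ?_, ?_, ?_, ?_⟩
      · rw [h10']; ring
      · rw [h11', h.ones, h.place, htake, code_concat, hlen, Nat.one_mul]
      · rw [h12', h.target, htake, code_concat, hlen]
      · rw [h13', h.level]
      · rw [h9', h8']; ring
      · rw [h8']; exact h.head.trans (by rw [h.tail]; omega)
      · intro a ha
        have := h.head
        have := h.tail
        rw [hlo a (by omega), h.low a ha]
      · intro a ha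
        rw [hhi a (by omega), h.high a (by omega)]
      · rw [h8']
        exact h.queue.succ hn hch
  · intro s' h
    refine ⟨?_, h⟩
    simp only [RamExpr.eval, h.reg 4 (by decide), h4, h.level, Nat.sub_self]
  · simp only [RamExpr.cost]
    rw [show (2 * n) ^ us.length * (n * 102 + 24) + n * 20 + 44 =
      1 + 1 + 1 + 1 + ((2 * n) ^ us.length * (n * 102 + 24) + n * 20 + 40) by omega]

end Generation

/-! ### Relaxing the table, with soundness and progress kept abstract. -/

section Relaxation

/-! Further registers: 13 the number of rounds left, 14 the address of the current queue entry,
15, 16, 17 the table address of its tuple, its mark code and the complementary mark code; 18 the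
address of the current edge, 19, 20 the table addresses of the two parts, 22, 23 two colours. -/

/-- Between the memories `M` and `M'` only the table, which starts at `TB`, has changed; its values
have not decreased, and the invariant `P` is kept. -/
structure Adv (P : (ℕ → ℕ) → Prop) (TB : ℕ) (M M' : ℕ → ℕ) : Prop where
  low : ∀ a < TB, M' a = M a
  mono : ∀ a, M a ≤ M' a
  inv : P M → P M'

theorem Adv.refl (P : (ℕ → ℕ) → Prop) (TB : ℕ) (M : ℕ → ℕ) : Adv P TB M M :=
  ⟨fun _ _ => rfl, fun _ => le_rfl, id⟩

theorem Adv.trans {P : (ℕ → ℕ) → Prop} {TB : ℕ} {M M' M'' : ℕ → ℕ} (h : Adv P TB M M')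
    (h' : Adv P TB M' M'') : Adv P TB M M'' :=
  ⟨fun a ha => (h'.low a ha).trans (h.low a ha), fun a => (h.mono a).trans (h'.mono a),
    fun hP => h'.inv (h.inv hP)⟩

/-- The memory after the value at `a` has been raised to at least `v`. -/
def raise (M : ℕ → ℕ) (a v : ℕ) : ℕ → ℕ := Function.update M a (M a + (v - M a))

theorem le_raise (M : ℕ → ℕ) (a v : ℕ) : v ≤ raise M a v a := by
  simp only [raise, Function.update_self]; omega

theorem raise_adv {P : (ℕ → ℕ) → Prop} {TB a v : ℕ} {M : ℕ → ℕ} (ha : TB ≤ a)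
    (hP : P M → P (raise M a v)) : Adv P TB M (raise M a v) := by
  refine ⟨fun b hb => Function.update_of_ne (by omega) _ _, fun b => ?_, hP⟩
  by_cases h : b = a
  · subst h; simp [raise]
  · simp [raise, h]

/-- The table `M'` satisfies, relative to the table `M`, the inequalities that correspond to
recolouring at `A`, and to joining at `A` the parts at `a₁` and `a₂`. -/
def Relaxed (n c A a₁ a₂ : ℕ) (M M' : ℕ → ℕ) : Prop :=
  ∀ d < c, M (a₁ + d) + M (a₂ + d) - n ≤ M' (A + d) ∧ ∀ d' < c, M (A + d') - 1 ≤ M' (A + d)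

/-- Updates are made in place. As values only increase, an inequality obtained in the middle of a
round remains true between the tables at its beginning and its end. -/
theorem Relaxed.mono {n c A a₁ a₂ : ℕ} {M₀ M M' M'' : ℕ → ℕ} (h : Relaxed n c A a₁ a₂ M M')
    (h₀ : ∀ a, M₀ a ≤ M a) (h' : ∀ a, M' a ≤ M'' a) : Relaxed n c A a₁ a₂ M₀ M'' := by
  intro d hd
  obtain ⟨h1, h2⟩ := h d hd
  refine ⟨?_, fun d' hd' => ?_⟩
  · have := h₀ (a₁ + d)
    have := h₀ (a₂ + d)
    have := h' (A + d)
    omega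
  · have := h₀ (A + d')
    have := h' (A + d)
    have := h2 d' hd'
    omega

/-- The two kinds of relaxation keep the invariant `P`. -/
def Keeps (P : (ℕ → ℕ) → Prop) (n c A a₁ a₂ : ℕ) : Prop :=
  ∀ M, P M → ∀ d < c, P (raise M (A + d) (M (a₁ + d) + M (a₂ + d) - n)) ∧
    ∀ d' < c, P (raise M (A + d) (M (A + d') - 1))

/-- With truncated subtraction, `x + (v - x)` is the maximum of `x` and `v`, so no test is needed.
-/
def raiseExpr (a v : RamExpr) : RamProg :=
  .store a (.add (.cell a) (.sub v (.cell a)))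

def relaxRecolour : RamProg :=
  .seq (.assign 23 (.sub (.reg 23) (.num 1)))
    (raiseExpr (.add (.reg 15) (.reg 22)) (.sub (.cell (.add (.reg 15) (.reg 23))) (.num 1)))

theorem relaxRecolour_loop_runs {P : (ℕ → ℕ) → Prop} {TB n c A a₁ a₂ d : ℕ} {s : RamState}
    (hK : Keeps P n c A a₁ a₂) (hd : d < c) (hA : TB ≤ A) (h15 : s.reg 15 = A)
    (h22 : s.reg 22 = d) (h23 : s.reg 23 = c) :
    Runs (.loop (.reg 23) relaxRecolour) s (c * 32 + 2) fun s' =>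
      (∀ i < 23, s'.reg i = s.reg i) ∧ Adv P TB s.mem s'.mem ∧
      ∀ d' < c, s.mem (A + d') - 1 ≤ s'.mem (A + d) := by
  refine Runs.loop (N := c) (B := 30) (fun j s' => (∀ i < 23, s'.reg i = s.reg i) ∧
      s'.reg 23 = c - j ∧ Adv P TB s.mem s'.mem ∧
      ∀ d' < c, c - j ≤ d' → s.mem (A + d') - 1 ≤ s'.mem (A + d)) ?_ ?_ ?_ ?_
  · exact ⟨fun _ _ => rfl, by omega, .refl _ _ _, fun d' _ _ => by omega⟩
  · rintro j hj s₁ ⟨hf, hr, hadv, hrel⟩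
    have e15 : s₁.reg 15 = A := (hf 15 (by decide)).trans h15
    have e22 : s₁.reg 22 = d := (hf 22 (by decide)).trans h22
    refine ⟨by simp only [RamExpr.eval]; omega, .straight ⟨trivial, trivial⟩ (by decide) ?_⟩
    have hstep : relaxRecolour.step s₁ = ⟨Function.update s₁.reg 23 (c - (j + 1)),
        raise s₁.mem (A + d) (s₁.mem (A + (c - (j + 1))) - 1)⟩ := by
      simp [relaxRecolour, raiseExpr, RamProg.step, RamExpr.eval, raise, e15, e22, hr,
        Nat.sub_sub]
    rw [hstep]
    have hadv' : Adv P TB s₁.mem (raise s₁.mem (A + d) (s₁.mem (A + (c - (j + 1))) - 1)) :=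
      raise_adv (by omega) fun hP => (hK _ hP d hd).2 _ (by omega)
    refine ⟨fun i hi => ?_, by simp, hadv.trans hadv', fun d' hd' hle => ?_⟩
    · simp [hi.ne, hf i hi]
    · rcases Nat.lt_or_ge d' (c - j) with hlt | hge
      · obtain rfl : d' = c - (j + 1) := by omega
        have := hadv.mono (A + (c - (j + 1)))
        exact (Nat.sub_le_sub_right this 1).trans (le_raise _ _ _)
      · exact (hrel d' hd' hge).trans (hadv'.mono _)
  · rintro s₁ ⟨hf, hr, hadv, hrel⟩
    exact ⟨by simp only [RamExpr.eval]; omega, hf, hadv, fun d' hd' => hrel d' hd' (by omega)⟩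
  · simp only [RamExpr.cost]; omega

def relaxColour : RamProg :=
  .seq (.seq (.assign 22 (.sub (.reg 22) (.num 1))) <|
    .seq (raiseExpr (.add (.reg 15) (.reg 22))
      (.sub (.add (.cell (.add (.reg 19) (.reg 22))) (.cell (.add (.reg 20) (.reg 22))))
        (.reg 1))) (.assign 23 (.reg 3)))
    (.loop (.reg 23) relaxRecolour)

/-- The recolouring inequalities do not involve the edge, but they are relaxed in the same pass;
this is the quadratic dependence on `c` for each entry and edge. -/
theorem relaxColour_loop_runs {P : (ℕ → ℕ) → Prop} {TB n c A a₁ a₂ : ℕ} {s : RamState}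
    (hK : Keeps P n c A a₁ a₂) (hA : TB ≤ A) (h1 : s.reg 1 = n) (h3 : s.reg 3 = c)
    (h15 : s.reg 15 = A) (h19 : s.reg 19 = a₁) (h20 : s.reg 20 = a₂) (h22 : s.reg 22 = c) :
    Runs (.loop (.reg 22) relaxColour) s (c * (c * 32 + 44) + 2) fun s' =>
      (∀ i < 22, s'.reg i = s.reg i) ∧ Adv P TB s.mem s'.mem ∧
      Relaxed n c A a₁ a₂ s.mem s'.mem := by
  refine Runs.loop (N := c) (B := c * 32 + 42) (fun j s' => (∀ i < 22, s'.reg i = s.reg i) ∧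
      s'.reg 22 = c - j ∧ Adv P TB s.mem s'.mem ∧
      ∀ d < c, c - j ≤ d → s.mem (a₁ + d) + s.mem (a₂ + d) - n ≤ s'.mem (A + d) ∧
        ∀ d' < c, s.mem (A + d') - 1 ≤ s'.mem (A + d)) ?_ ?_ ?_ ?_
  · exact ⟨fun _ _ => rfl, by omega, .refl _ _ _, fun d' _ _ => by omega⟩
  · rintro j hj s₁ ⟨hf, hr, hadv, hrel⟩
    have e15 : s₁.reg 15 = A := (hf 15 (by decide)).trans h15
    have e19 : s₁.reg 19 = a₁ := (hf 19 (by decide)).trans h19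
    have e20 : s₁.reg 20 = a₂ := (hf 20 (by decide)).trans h20
    have e1 : s₁.reg 1 = n := (hf 1 (by decide)).trans h1
    have e3 : s₁.reg 3 = c := (hf 3 (by decide)).trans h3
    refine ⟨by simp only [RamExpr.eval]; omega, ?_⟩
    set d := c - (j + 1) with hd
    refine Runs.seq (T₁ := 40) (T₂ := c * 32 + 2) (R := fun s' => s' =
      ⟨Function.update (Function.update s₁.reg 22 d) 23 c,
        raise s₁.mem (A + d) (s₁.mem (a₁ + d) + s₁.mem (a₂ + d) - n)⟩)
      (.straight ⟨trivial, trivial, trivial⟩ (by decide) ?_) ?_ (by omega)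
    · simp [raiseExpr, RamProg.step, RamExpr.eval, raise, e15, e19, e20, e1, e3, hr,
        Nat.sub_sub, hd]
    rintro _ rfl
    have hadv₁ : Adv P TB s₁.mem
        (raise s₁.mem (A + d) (s₁.mem (a₁ + d) + s₁.mem (a₂ + d) - n)) :=
      raise_adv (by omega) fun hP => (hK _ hP d (by omega)).1
    refine (relaxRecolour_loop_runs (TB := TB) (d := d) hK (by omega) hA (by simp [e15]) (by simp)
      (by simp)).mono le_rfl ?_
    rintro s₂ ⟨hf₂, hadv₂, hrel₂⟩
    refine ⟨fun i hi => ?_, ?_, (hadv.trans hadv₁).trans hadv₂, fun d₁ hd₁ hle => ?_⟩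
    · rw [hf₂ i (by omega)]
      simp [show i ≠ 23 by omega, show i ≠ 22 by omega, hf i hi]
    · rw [hf₂ 22 (by decide)]
      simp
    · rcases Nat.lt_or_ge d₁ (c - j) with hlt | hge
      · obtain rfl : d₁ = d := by omega
        refine ⟨?_, fun d' hd' => ?_⟩
        · refine le_trans ?_ (hadv₂.mono _)
          refine le_trans ?_ (le_raise _ _ _)
          have := hadv.mono (a₁ + d)
          have := hadv.mono (a₂ + d)
          omega
        · refine le_trans ?_ (hrel₂ d' hd')
          exact Nat.sub_le_sub_right ((hadv.trans hadv₁).mono _) 1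
      · have := (hadv₁.trans hadv₂).mono (A + d₁)
        exact ⟨(hrel d₁ hd₁ hge).1.trans this, fun d' hd' => ((hrel d₁ hd₁ hge).2 d' hd').trans this⟩
  · rintro s₁ ⟨hf, hr, hadv, hrel⟩
    exact ⟨by simp only [RamExpr.eval]; omega, hf, hadv, fun d' hd' => hrel d' hd' (by omega)⟩
  · simp only [RamExpr.cost]
    rw [show c * 32 + 44 = 1 + 1 + (c * 32 + 42) by omega]

/-- The table address of the part of the entry at `h` that keeps the marked positions, the others
being replaced by the first end of the edge at `e`. -/
def leftAddr (TB Pt : ℕ) (M : ℕ → ℕ) (h e : ℕ) : ℕ :=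
  TB + M (h + 1) + M e * (Pt - M (h + 2))

/-- The table address of the part of the entry at `h` in which the marked positions are replaced by
the second end of the edge at `e`. -/
def rightAddr (TB : ℕ) (M : ℕ → ℕ) (h e : ℕ) : ℕ :=
  TB + (M h - M (h + 1)) + M (e + 1) * M (h + 2)

def relaxEdge : RamProg :=
  .seq (.seq (.assign 19 (.add (.reg 9) (.cell (.add (.reg 14) (.num 1)))))
    (.assign 21 (.cell (.reg 18)))) <|
  .seq (mulAdd 19 21 17) <|
  .seq (.seq (.assign 20 (.add (.reg 9)
      (.sub (.cell (.reg 14)) (.cell (.add (.reg 14) (.num 1))))))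
    (.assign 21 (.cell (.add (.reg 18) (.num 1))))) <|
  .seq (mulAdd 20 21 16) <|
  .seq (.assign 22 (.reg 3)) <|
  .seq (.loop (.reg 22) relaxColour) (.assign 18 (.add (.reg 18) (.num 2)))

theorem relaxEdge_runs {P : (ℕ → ℕ) → Prop} {TB Pt n c h e : ℕ} {s : RamState}
    (hK : Keeps P n c (TB + s.mem h) (leftAddr TB Pt s.mem h e) (rightAddr TB s.mem h e))
    (hx : s.mem e ≤ n) (hy : s.mem (e + 1) ≤ n)
    (h1 : s.reg 1 = n) (h3 : s.reg 3 = c) (h9 : s.reg 9 = TB) (h14 : s.reg 14 = h)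
    (h15 : s.reg 15 = TB + s.mem h) (h16 : s.reg 16 = s.mem (h + 2))
    (h17 : s.reg 17 = Pt - s.mem (h + 2)) (h18 : s.reg 18 = e) :
    Runs relaxEdge s (c * (c * 32 + 44) + n * 20 + 50) fun s' =>
      (∀ i < 18, s'.reg i = s.reg i) ∧ s'.reg 18 = e + 2 ∧ Adv P TB s.mem s'.mem ∧
      Relaxed n c (TB + s.mem h) (leftAddr TB Pt s.mem h e) (rightAddr TB s.mem h e)
        s.mem s'.mem := by
  unfold relaxEdge
  refine Runs.seq (.straight ⟨trivial, trivial⟩ (le_refl 10) rfl)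
    (T₂ := c * (c * 32 + 44) + n * 20 + 40) ?_ (by omega)
  rintro _ rfl
  refine Runs.seq (mulAdd_runs (T := n * 10 + 2) (by decide) (by decide) (by decide) _
    (by simp [RamProg.step, RamExpr.eval, h18]; omega))
    (T₂ := c * (c * 32 + 44) + n * 10 + 38) ?_ (by omega)
  rintro _ rfl
  refine Runs.seq (.straight ⟨trivial, trivial⟩ (le_refl 15) rfl)
    (T₂ := c * (c * 32 + 44) + n * 10 + 23) ?_ (by omega)
  rintro _ rfl
  refine Runs.seq (mulAdd_runs (T := n * 10 + 2) (by decide) (by decide) (by decide) _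
    (by simp [RamProg.step, RamExpr.eval, h18]; omega))
    (T₂ := c * (c * 32 + 44) + 20) ?_ (by omega)
  rintro _ rfl
  refine Runs.seq (.straight trivial (le_refl 2) rfl)
    (T₂ := c * (c * 32 + 44) + 10) ?_ (by omega)
  rintro _ rfl
  refine Runs.seq (relaxColour_loop_runs (TB := TB) hK ?_ ?_ ?_ ?_ ?_ ?_ ?_) (T₂ := 4) ?_
    (by omega)
  · omega
  · simp [RamProg.step, h1]
  · simp [RamProg.step, h3]
  · simp [RamProg.step, h15]
  · simp [RamProg.step, RamExpr.eval, h9, h14, h17, h18, leftAddr]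
  · simp [RamProg.step, RamExpr.eval, h9, h14, h16, h18, rightAddr]
  · simp [RamProg.step, RamExpr.eval, h3]
  rintro s₁ ⟨hf, hadv, hrel⟩
  simp only [RamProg.step] at hadv hrel
  refine .straight trivial (by decide) ?_
  refine ⟨fun i hi => ?_, ?_, hadv, hrel⟩
  · simp [RamProg.step, hi.ne, hf i (by omega), show i ≠ 19 by omega, show i ≠ 20 by omega,
      show i ≠ 21 by omega, show i ≠ 22 by omega]
  · simp [RamProg.step, RamExpr.eval, hf 18 (by decide), h18]

def relaxEntry : RamProg :=
  .seq (.seq (.assign 15 (.add (.reg 9) (.cell (.reg 14)))) <|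
    .seq (.assign 16 (.cell (.add (.reg 14) (.num 2)))) <|
    .seq (.assign 17 (.sub (.reg 11) (.reg 16))) (.assign 18 (.reg 6))) <|
  .seq (.loop (.sub (.reg 7) (.reg 18)) relaxEdge) (.assign 14 (.add (.reg 14) (.num 3)))

/-- Queue and edges lie below the table, so the addresses computed from them stay fixed throughout
the relaxation. -/
theorem leftAddr_congr {TB Pt h e : ℕ} {M M' : ℕ → ℕ} (hM : ∀ a < TB, M' a = M a)
    (hh : h + 3 ≤ TB) (he : e + 2 ≤ TB) : leftAddr TB Pt M' h e = leftAddr TB Pt M h e := by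
  simp only [leftAddr, hM (h + 1) (by omega), hM (h + 2) (by omega), hM e (by omega)]

theorem rightAddr_congr {TB h e : ℕ} {M M' : ℕ → ℕ} (hM : ∀ a < TB, M' a = M a)
    (hh : h + 3 ≤ TB) (he : e + 2 ≤ TB) : rightAddr TB M' h e = rightAddr TB M h e := by
  simp only [rightAddr, hM (h + 1) (by omega), hM (h + 2) (by omega), hM h (by omega),
    hM (e + 1) (by omega)]

theorem relaxEntry_runs {P : (ℕ → ℕ) → Prop} {TB Pt n m c h E : ℕ} {s : RamState}
    (hK : ∀ j < m, Keeps P n c (TB + s.mem h) (leftAddr TB Pt s.mem h (E + 2 * j))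
      (rightAddr TB s.mem h (E + 2 * j)))
    (hx : ∀ j < m, s.mem (E + 2 * j) ≤ n ∧ s.mem (E + 2 * j + 1) ≤ n)
    (hh : h + 3 ≤ TB) (hE : E + 2 * m ≤ TB)
    (h1 : s.reg 1 = n) (h3 : s.reg 3 = c) (h6 : s.reg 6 = E) (h7 : s.reg 7 = E + 2 * m)
    (h9 : s.reg 9 = TB) (h11 : s.reg 11 = Pt) (h14 : s.reg 14 = h) :
    Runs relaxEntry s (m * (c * (c * 32 + 44) + n * 20 + 54) + 26) fun s' =>
      (∀ i < 14, s'.reg i = s.reg i) ∧ s'.reg 14 = h + 3 ∧ Adv P TB s.mem s'.mem ∧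
      ∀ j < m, Relaxed n c (TB + s.mem h) (leftAddr TB Pt s.mem h (E + 2 * j))
        (rightAddr TB s.mem h (E + 2 * j)) s.mem s'.mem := by
  unfold relaxEntry
  refine Runs.seq (.straight ⟨trivial, trivial, trivial, trivial⟩ (le_refl 16) rfl)
    (T₂ := m * (c * (c * 32 + 44) + n * 20 + 54) + 10) ?_ (by omega)
  rintro _ rfl
  refine Runs.seq (T₁ := m * (c * (c * 32 + 44) + n * 20 + 54) + 4) (T₂ := 4) (R := fun s' =>
      (∀ i < 15, s'.reg i = s.reg i) ∧ Adv P TB s.mem s'.mem ∧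
      ∀ j < m, Relaxed n c (TB + s.mem h) (leftAddr TB Pt s.mem h (E + 2 * j))
        (rightAddr TB s.mem h (E + 2 * j)) s.mem s'.mem) ?_ ?_ (by omega)
  · refine Runs.loop (N := m) (B := c * (c * 32 + 44) + n * 20 + 50) (fun j s' =>
      (∀ i < 15, s'.reg i = s.reg i) ∧ s'.reg 15 = TB + s.mem h ∧
      s'.reg 16 = s.mem (h + 2) ∧ s'.reg 17 = Pt - s.mem (h + 2) ∧ s'.reg 18 = E + 2 * j ∧
      Adv P TB s.mem s'.mem ∧
      ∀ i < j, Relaxed n c (TB + s.mem h) (leftAddr TB Pt s.mem h (E + 2 * i))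
        (rightAddr TB s.mem h (E + 2 * i)) s.mem s'.mem) ?_ ?_ ?_ ?_
    · refine ⟨fun i hi => ?_, ?_, ?_, ?_, ?_, .refl _ _ _, fun i hi =>
        absurd hi (Nat.not_lt_zero _)⟩
      · simp [RamProg.step, hi.ne, show i ≠ 16 by omega, show i ≠ 17 by omega,
          show i ≠ 18 by omega]
      all_goals simp [RamProg.step, RamExpr.eval, h9, h14, h11, h6]
    · rintro j hj s₁ ⟨hf, h15, h16, h17, h18, hadv, hrel⟩
      have l0 := hadv.low h (by omega)
      have l2 := hadv.low (h + 2) (by omega)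
      have ll := leftAddr_congr (Pt := Pt) hadv.low hh (show E + 2 * j + 2 ≤ TB by omega)
      have lr := rightAddr_congr hadv.low hh (show E + 2 * j + 2 ≤ TB by omega)
      refine ⟨?_, (relaxEdge_runs (P := P) (TB := TB) (Pt := Pt) (n := n) (c := c) (h := h)
        (e := E + 2 * j) ?_ ?_ ?_ ?_ ?_ ?_ ?_ ?_ ?_ ?_ h18).mono le_rfl ?_⟩
      · simp only [RamExpr.eval, hf 7 (by decide)]; omega
      · rw [l0, ll, lr]; exact hK j hj
      · rw [hadv.low _ (by omega)]; exact (hx j hj).1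
      · rw [hadv.low _ (by omega)]; exact (hx j hj).2
      · rw [hf 1 (by decide), h1]
      · rw [hf 3 (by decide), h3]
      · rw [hf 9 (by decide), h9]
      · rw [hf 14 (by decide), h14]
      · rw [l0, h15]
      · rw [l2, h16]
      · rw [l2, h17]
      · rintro s₂ ⟨hf₂, h18₂, hadv₂, hrel₂⟩
        rw [l0, ll, lr] at hrel₂
        refine ⟨fun i hi => (hf₂ i (by omega)).trans (hf i hi), (hf₂ 15 (by decide)).trans h15,
          (hf₂ 16 (by decide)).trans h16, (hf₂ 17 (by decide)).trans h17, h18₂,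
          hadv.trans hadv₂, fun i hi => ?_⟩
        rcases Nat.lt_succ_iff_lt_or_eq.1 hi with hi | rfl
        · exact (hrel i hi).mono (fun _ => le_rfl) hadv₂.mono
        · exact hrel₂.mono hadv.mono (fun _ => le_rfl)
    · rintro s₁ ⟨hf, h15, h16, h17, h18, hadv, hrel⟩
      refine ⟨?_, hf, hadv, hrel⟩
      simp only [RamExpr.eval, hf 7 (by decide)]; omega
    · simp only [RamExpr.cost]
      rw [show c * (c * 32 + 44) + n * 20 + 54 =
        1 + 1 + 1 + 1 + (c * (c * 32 + 44) + n * 20 + 50) by omega]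
  · rintro s₁ ⟨hf, hadv, hrel⟩
    refine .straight trivial (by decide) ?_
    refine ⟨fun i hi => ?_, ?_, hadv, hrel⟩
    · simp [RamProg.step, hi.ne, hf i (by omega)]
    · simp [RamProg.step, RamExpr.eval, hf 14 (by decide), h14]

def relaxRound : RamProg :=
  .seq (.seq (.assign 13 (.sub (.reg 13) (.num 1))) (.assign 14 (.reg 8)))
    (.loop (.sub (.reg 9) (.reg 14)) relaxEntry)

def relaxAll : RamProg :=
  .seq (.assign 13 (.add (.reg 1) (.reg 1))) (.loop (.reg 13) relaxRound)

/-- The registers and the part of the memory below the table, as they are during the relaxation: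
`N` queue entries start at `H`, and `m` edges at `E`. -/
structure Ready (n m c H N E Pt : ℕ) (s : RamState) : Prop where
  order : s.reg 1 = n
  colours : s.reg 3 = c
  edges : s.reg 6 = E
  edges_end : s.reg 7 = E + 2 * m
  head : s.reg 8 = H
  tail : s.reg 9 = H + 3 * N
  ones : s.reg 11 = Pt
  below : E + 2 * m ≤ H
  ends : ∀ j < m, s.mem (E + 2 * j) ≤ n ∧ s.mem (E + 2 * j + 1) ≤ n

theorem Ready.congr {n m c H N E Pt : ℕ} {s s' : RamState} (h : Ready n m c H N E Pt s)
    (hr : ∀ i < 13, s'.reg i = s.reg i) (hm : ∀ a < H + 3 * N, s'.mem a = s.mem a) :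
    Ready n m c H N E Pt s' := by
  have hb := h.below
  refine ⟨?_, ?_, ?_, ?_, ?_, ?_, ?_, hb, fun j hj => ?_⟩
  · rw [hr 1 (by decide), h.order]
  · rw [hr 3 (by decide), h.colours]
  · rw [hr 6 (by decide), h.edges]
  · rw [hr 7 (by decide), h.edges_end]
  · rw [hr 8 (by decide), h.head]
  · rw [hr 9 (by decide), h.tail]
  · rw [hr 11 (by decide), h.ones]
  · rw [hm _ (by omega), hm _ (by omega)]
    exact h.ends j hj

theorem relaxRound_runs {P : (ℕ → ℕ) → Prop} {n m c H N E Pt : ℕ} {s : RamState}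
    (hs : Ready n m c H N E Pt s)
    (hK : ∀ q < N, ∀ j < m, Keeps P n c (H + 3 * N + s.mem (H + 3 * q))
      (leftAddr (H + 3 * N) Pt s.mem (H + 3 * q) (E + 2 * j))
      (rightAddr (H + 3 * N) s.mem (H + 3 * q) (E + 2 * j))) :
    Runs relaxRound s (N * (m * (c * (c * 32 + 44) + n * 20 + 54) + 30) + 10) fun s' =>
      (∀ i < 13, s'.reg i = s.reg i) ∧ s'.reg 13 = s.reg 13 - 1 ∧
      Adv P (H + 3 * N) s.mem s'.mem ∧
      ∀ q < N, ∀ j < m, Relaxed n c (H + 3 * N + s.mem (H + 3 * q))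
        (leftAddr (H + 3 * N) Pt s.mem (H + 3 * q) (E + 2 * j))
        (rightAddr (H + 3 * N) s.mem (H + 3 * q) (E + 2 * j)) s.mem s'.mem := by
  set TB := H + 3 * N with hTB
  have hb := hs.below
  refine Runs.seq (.straight ⟨trivial, trivial⟩ (le_refl 6) rfl)
    (T₂ := N * (m * (c * (c * 32 + 44) + n * 20 + 54) + 30) + 4) ?_ (by omega)
  rintro _ rfl
  refine Runs.loop (N := N) (B := m * (c * (c * 32 + 44) + n * 20 + 54) + 26) (fun k s' =>
      (∀ i < 13, s'.reg i = s.reg i) ∧ s'.reg 13 = s.reg 13 - 1 ∧ s'.reg 14 = H + 3 * k ∧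
      Adv P TB s.mem s'.mem ∧
      ∀ q < k, ∀ j < m, Relaxed n c (TB + s.mem (H + 3 * q))
        (leftAddr TB Pt s.mem (H + 3 * q) (E + 2 * j))
        (rightAddr TB s.mem (H + 3 * q) (E + 2 * j)) s.mem s'.mem) ?_ ?_ ?_ ?_
  · refine ⟨fun i hi => ?_, ?_, ?_, .refl _ _ _, fun i hi => absurd hi (Nat.not_lt_zero _)⟩
    · simp [RamProg.step, hi.ne, show i ≠ 14 by omega]
    all_goals simp [RamProg.step, RamExpr.eval, hs.head]
  · rintro k hk s₁ ⟨hf, h13, h14, hadv, hrel⟩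
    have hs₁ := hs.congr hf hadv.low
    have l0 := hadv.low (H + 3 * k) (by omega)
    have ll : ∀ j < m, leftAddr TB Pt s₁.mem (H + 3 * k) (E + 2 * j) =
        leftAddr TB Pt s.mem (H + 3 * k) (E + 2 * j) := fun j hj =>
      leftAddr_congr hadv.low (by omega) (by omega)
    have lr : ∀ j < m, rightAddr TB s₁.mem (H + 3 * k) (E + 2 * j) =
        rightAddr TB s.mem (H + 3 * k) (E + 2 * j) := fun j hj =>
      rightAddr_congr hadv.low (by omega) (by omega)
    refine ⟨by simp only [RamExpr.eval, hs₁.tail]; omega,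
      (relaxEntry_runs (P := P) (TB := TB) (Pt := Pt) (h := H + 3 * k) (fun j hj => ?_)
      hs₁.ends (by omega) (by omega) hs₁.order hs₁.colours hs₁.edges hs₁.edges_end hs₁.tail
      hs₁.ones h14).mono le_rfl ?_⟩
    · rw [l0, ll j hj, lr j hj]; exact hK k hk j hj
    · rintro s₂ ⟨hf₂, h14₂, hadv₂, hrel₂⟩
      refine ⟨fun i hi => (hf₂ i (by omega)).trans (hf i hi), (hf₂ 13 (by decide)).trans h13,
        h14₂, hadv.trans hadv₂, fun q hq j hj => ?_⟩
      rcases Nat.lt_succ_iff_lt_or_eq.1 hq with hq | rfl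
      · exact (hrel q hq j hj).mono (fun _ => le_rfl) hadv₂.mono
      · have := hrel₂ j hj
        rw [l0, ll j hj, lr j hj] at this
        exact this.mono hadv.mono (fun _ => le_rfl)
  · rintro s₁ ⟨hf, h13, h14, hadv, hrel⟩
    have hs₁ := hs.congr hf hadv.low
    exact ⟨by simp only [RamExpr.eval, hs₁.tail]; omega, hf, h13, hadv, hrel⟩
  · simp only [RamExpr.cost]
    rw [show m * (c * (c * 32 + 44) + n * 20 + 54) + 30 =
      1 + 1 + 1 + 1 + (m * (c * (c * 32 + 44) + n * 20 + 54) + 26) by omega]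

/-- `P` must survive every single update, whereas `Φ` has to advance only over a full round; they
will be `Sound` and `Complete`. -/
theorem relaxAll_runs {P : (ℕ → ℕ) → Prop} {Φ : ℕ → (ℕ → ℕ) → Prop} {n m c H N E Pt : ℕ}
    {s : RamState} (hs : Ready n m c H N E Pt s)
    (hK : ∀ q < N, ∀ j < m, Keeps P n c (H + 3 * N + s.mem (H + 3 * q))
      (leftAddr (H + 3 * N) Pt s.mem (H + 3 * q) (E + 2 * j))
      (rightAddr (H + 3 * N) s.mem (H + 3 * q) (E + 2 * j)))
    (hP : P s.mem) (h0 : Φ 0 s.mem)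
    (hΦ : ∀ k M M', Φ k M → Adv P (H + 3 * N) M M' →
      (∀ q < N, ∀ j < m, Relaxed n c (H + 3 * N + s.mem (H + 3 * q))
        (leftAddr (H + 3 * N) Pt s.mem (H + 3 * q) (E + 2 * j))
        (rightAddr (H + 3 * N) s.mem (H + 3 * q) (E + 2 * j)) M M') → Φ (k + 1) M') :
    Runs relaxAll s ((n + n) * (N * (m * (c * (c * 32 + 44) + n * 20 + 54) + 30) + 12) + 6)
      fun s' => (∀ i < 13, s'.reg i = s.reg i) ∧ (∀ a < H + 3 * N, s'.mem a = s.mem a) ∧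
        P s'.mem ∧ Φ (n + n) s'.mem := by
  have hb := hs.below
  refine Runs.seq (.straight trivial (le_refl 4) rfl)
    (T₂ := (n + n) * (N * (m * (c * (c * 32 + 44) + n * 20 + 54) + 30) + 12) + 2) ?_ (by omega)
  rintro _ rfl
  refine Runs.loop (N := n + n) (B := N * (m * (c * (c * 32 + 44) + n * 20 + 54) + 30) + 10)
    (fun k s' => (∀ i < 13, s'.reg i = s.reg i) ∧ s'.reg 13 = n + n - k ∧
      Adv P (H + 3 * N) s.mem s'.mem ∧ Φ k s'.mem) ?_ ?_ ?_ ?_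
  · refine ⟨fun i hi => ?_, ?_, .refl _ _ _, h0⟩
    · simp [RamProg.step, hi.ne]
    · simp [RamProg.step, RamExpr.eval, hs.order]
  · rintro k hk s₁ ⟨hf, h13, hadv, hk'⟩
    have hs₁ := hs.congr hf hadv.low
    have l0 : ∀ q < N, s₁.mem (H + 3 * q) = s.mem (H + 3 * q) := fun q hq =>
      hadv.low _ (by omega)
    have ll : ∀ q < N, ∀ j < m, leftAddr (H + 3 * N) Pt s₁.mem (H + 3 * q) (E + 2 * j) =
        leftAddr (H + 3 * N) Pt s.mem (H + 3 * q) (E + 2 * j) := fun q hq j hj =>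
      leftAddr_congr hadv.low (by omega) (by omega)
    have lr : ∀ q < N, ∀ j < m, rightAddr (H + 3 * N) s₁.mem (H + 3 * q) (E + 2 * j) =
        rightAddr (H + 3 * N) s.mem (H + 3 * q) (E + 2 * j) := fun q hq j hj =>
      rightAddr_congr hadv.low (by omega) (by omega)
    refine ⟨by simp only [RamExpr.eval]; omega,
      (relaxRound_runs (P := P) hs₁ fun q hq j hj => ?_).mono le_rfl ?_⟩
    · rw [l0 q hq, ll q hq j hj, lr q hq j hj]; exact hK q hq j hj
    · rintro s₂ ⟨hf₂, h13₂, hadv₂, hrel₂⟩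
      refine ⟨fun i hi => (hf₂ i hi).trans (hf i hi), by omega, hadv.trans hadv₂,
        hΦ k _ _ hk' hadv₂ fun q hq j hj => ?_⟩
      have := hrel₂ q hq j hj
      rwa [l0 q hq, ll q hq j hj, lr q hq j hj] at this
  · rintro s₁ ⟨hf, h13, hadv, hk'⟩
    exact ⟨by simp only [RamExpr.eval]; omega, hf, hadv.low, hadv.inv hP, hk'⟩
  · simp only [RamExpr.cost]
    rw [show N * (m * (c * (c * 32 + 44) + n * 20 + 54) + 30) + 12 =
      1 + 1 + (N * (m * (c * (c * 32 + 44) + n * 20 + 54) + 30) + 10) by omega]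

end Relaxation

/-! ### Arithmetic of tuple codes and table addresses. -/

section Codes

theorem code_nil {α : Type*} (n c : ℕ) (f : α → ℕ) : code n c f [] = 0 := by
  simp [code]

theorem code_cons {α : Type*} (n c : ℕ) (f : α → ℕ) (x : α) (σ : List α) :
    code n c f (x :: σ) = c * f x + n * code n c f σ := by
  simp only [code, List.map_cons, Nat.ofDigits_cons]
  ring

theorem code_map {α β : Type*} (n c : ℕ) (f : β → ℕ) (g : α → β) (σ : List α) :
    code n c f (σ.map g) = code n c (fun x => f (g x)) σ := by
  simp only [code, List.map_map]
  rfl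

theorem code_add {α : Type*} (n c : ℕ) (f g : α → ℕ) (σ : List α) :
    code n c f σ + code n c g σ = code n c (fun x => f x + g x) σ := by
  induction σ with
  | nil => simp only [code_nil]
  | cons x σ ih => simp only [code_cons, ← ih]; ring

theorem mul_code {α : Type*} (n c a : ℕ) (f : α → ℕ) (σ : List α) :
    a * code n c f σ = code n c (fun x => a * f x) σ := by
  induction σ with
  | nil => simp only [code_nil, Nat.mul_zero]
  | cons x σ ih => simp only [code_cons, ← ih]; ring

theorem code_one_congr {α β : Type*} (n c : ℕ) {σ : List α} {τ : List β}
    (h : σ.length = τ.length) : code n c (fun _ => 1) σ = code n c (fun _ => 1) τ := by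
  simp only [code, List.map_const', h]

/-- The code of a tuple of vertices. -/
def tupleCode (n c : ℕ) (t : List (Fin n)) : ℕ := code n c (fun u : Fin n => (u : ℕ)) t

/-- Lets the seeding address a constant tuple by one multiplication with the sum of the place
values. -/
theorem tupleCode_replicate (n c k : ℕ) (u : Fin n) {α : Type*} {σ : List α}
    (h : σ.length = k) :
    tupleCode n c (List.replicate k u) = u * code n c (fun _ => 1) σ := by
  rw [code_one_congr (τ := List.replicate k u) n c (by simp [h]), mul_code, tupleCode]
  simp only [code, List.map_replicate, Nat.mul_one]

/-- The colour is the remainder modulo `c`, and the vertices are base-`n` digits of the quotient.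
Hence distinct pairs of tuple and colour occupy distinct cells. -/
theorem tupleCode_add_inj {n c : ℕ} {t t' : List (Fin n)} (h : t.length = t'.length) {d d' : ℕ}
    (hd : d < c) (hd' : d' < c) (he : tupleCode n c t + d = tupleCode n c t' + d') :
    t = t' ∧ d = d' := by
  have key : ∀ t t' : List (Fin n), t.length = t'.length →
      Nat.ofDigits n (t.map fun u : Fin n => (u : ℕ)) = Nat.ofDigits n (t'.map fun u : Fin n => (u : ℕ)) →
      t = t' := by
    intro t
    induction t with
    | nil =>
      intro t' h _
      exact (List.length_eq_zero_iff.1 h.symm).symm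
    | cons a t ih =>
      intro t' h he
      cases t' with
      | nil => simp at h
      | cons a' t' =>
        simp only [List.map_cons, Nat.ofDigits_cons] at he
        have hm := congrArg (· % n) he
        simp only [Nat.add_mul_mod_self_left, Nat.mod_eq_of_lt a.isLt,
          Nat.mod_eq_of_lt a'.isLt] at hm
        obtain rfl : a = a' := Fin.ext hm
        have := Nat.eq_of_mul_eq_mul_left (a.pos) (Nat.add_left_cancel he)
        rw [ih t' (by simpa using h) this]
  have hm := congrArg (· % c) he
  simp only [tupleCode, code, Nat.mul_add_mod_self_left, Nat.mod_eq_of_lt hd,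
    Nat.mod_eq_of_lt hd'] at hm
  subst hm
  exact ⟨key t t' h (Nat.eq_of_mul_eq_mul_left (by omega) (Nat.add_right_cancel he)), rfl⟩

variable {n c : ℕ}

/-- The tuple of a marked tuple. -/
def wholeTuple (σ : List (Fin n × Bool)) : List (Fin n) := σ.map Prod.fst

/-- The marked part of a tuple, with `x` at the other positions. -/
def leftTuple (x : Fin n) (σ : List (Fin n × Bool)) : List (Fin n) :=
  σ.map fun p => if p.2 then p.1 else x

/-- The unmarked part of a tuple, with `y` at the other positions. -/
def rightTuple (y : Fin n) (σ : List (Fin n × Bool)) : List (Fin n) :=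
  σ.map fun p => if p.2 then y else p.1

theorem IsEntry.whole {M : ℕ → ℕ} {h : ℕ} {σ : List (Fin n × Bool)} (hσ : IsEntry c M h σ) :
    M h = tupleCode n c (wholeTuple σ) := by
  rw [hσ.1, tupleCode, wholeTuple, code_map]

/-- Subtracting the mark code from the all-ones code involves no borrowing, so it gives the code of
the complementary positions, where `x` is then inserted. -/
theorem IsEntry.leftAddr_eq {M : ℕ → ℕ} {h e TB : ℕ} {σ : List (Fin n × Bool)}
    (hσ : IsEntry c M h σ) {x : Fin n} (hx : M e = x) {α : Type*} {τ : List α}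
    (hτ : σ.length = τ.length) :
    leftAddr TB (code n c (fun _ => 1) τ) M h e = TB + tupleCode n c (leftTuple x σ) := by
  have h1 : code n c (fun _ => 1) τ - M (h + 2) =
      code n c (fun p : Fin n × Bool => if p.2 then 0 else 1) σ := by
    rw [← code_one_congr n c hτ, hσ.2.2]
    apply Nat.sub_eq_of_eq_add
    rw [code_add]
    congr 1
    funext p
    cases p.2 <;> simp
  rw [leftAddr, h1, hσ.2.1, hx, mul_code, Nat.add_assoc, code_add, tupleCode, leftTuple, code_map]
  congr 2
  funext p
  cases p.2 <;> simp

theorem IsEntry.rightAddr_eq {M : ℕ → ℕ} {h e TB : ℕ} {σ : List (Fin n × Bool)}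
    (hσ : IsEntry c M h σ) {y : Fin n} (hy : M (e + 1) = y) :
    rightAddr TB M h e = TB + tupleCode n c (rightTuple y σ) := by
  have h1 : M h - M (h + 1) =
      code n c (fun p : Fin n × Bool => if p.2 then 0 else (p.1 : ℕ)) σ := by
    rw [hσ.1, hσ.2.1]
    apply Nat.sub_eq_of_eq_add
    rw [code_add]
    congr 1
    funext p
    cases p.2 <;> simp
  rw [rightAddr, h1, hσ.2.2, hy, mul_code, Nat.add_assoc, code_add, tupleCode, rightTuple,
    code_map]
  congr 2
  funext p
  cases p.2 <;> simp

end Codes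

/-! ### Soundness, completeness and optimality of the table. -/

section Table

variable {n c : ℕ}

/-- The saving `v` is justified for linking the vertices of `t` in colour `d`. -/
def Justified (G : SimpleGraph (Fin n)) (ω : Fin n → Fin c) (t : List (Fin n)) (d : Fin c)
    (v : ℕ) : Prop :=
  ∃ X r N, Build G ω X d r N ∧ (∀ u ∈ t, u ∈ X) ∧ r + v ≤ n

/-- The table that starts at `TB` holds justified savings for all tuples of length `k`. -/
def Sound (G : SimpleGraph (Fin n)) (ω : Fin n → Fin c) (k TB : ℕ) (M : ℕ → ℕ) : Prop :=
  ∀ t : List (Fin n), t.length = k → ∀ d : Fin c, Justified G ω t d (M (TB + tupleCode n c t + d))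

/-- The savings in the table that starts at `TB` are at least those of all assemblies in which the
numbers of pieces and of recolourings add up to at most `j + 1`. -/
def Complete (G : SimpleGraph (Fin n)) (ω : Fin n → Fin c) (k TB j : ℕ) (M : ℕ → ℕ) : Prop :=
  ∀ X d r N, Build G ω X d r N → r + N ≤ j + 1 → ∀ t : List (Fin n), t.length = k →
    (∀ u ∈ t, u ∈ X) → n ≤ r + M (TB + tupleCode n c t + d)

variable {G : SimpleGraph (Fin n)} {ω : Fin n → Fin c} {k TB : ℕ}

theorem Justified.anti {t : List (Fin n)} {d : Fin c} {v v' : ℕ} (h : Justified G ω t d v)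
    (hv : v' ≤ v) : Justified G ω t d v' := by
  obtain ⟨X, r, N, hB, ht, hr⟩ := h
  exact ⟨X, r, N, hB, ht, by omega⟩

theorem justified_zero (hG : G.Connected) (t : List (Fin n)) (d : Fin c) :
    Justified G ω t d 0 := by
  obtain ⟨N, hN⟩ := exists_build_univ (ω := ω) hG d
  exact ⟨_, _, N, hN, fun u _ => Set.mem_univ u, by simp⟩

theorem Justified.recolour (hG : G.Connected) {t : List (Fin n)} {d : Fin c} {v : ℕ}
    (h : Justified G ω t d v) (d' : Fin c) : Justified G ω t d' (v - 1) := by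
  obtain ⟨X, r, N, hB, ht, hr⟩ := h
  by_cases hv : v = 0
  · simpa [hv] using justified_zero hG t d'
  · exact ⟨X, r + 1, N, hB.recolour d', ht, by omega⟩

/-- When both kinds of position occur, `x` and `y` appear in the two tuples, so both assembled sets
contain their end of the edge. Otherwise one of the tuples is the whole tuple, and the claimed
saving is no larger than its saving because the other is at most `n`. -/
theorem Justified.join (hG : G.Connected) {σ : List (Fin n × Bool)} {x y : Fin n}
    (hxy : G.Adj x y) {d : Fin c} {v w : ℕ} (hv : Justified G ω (leftTuple x σ) d v)
    (hw : Justified G ω (rightTuple y σ) d w) :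
    Justified G ω (wholeTuple σ) d (v + w - n) := by
  by_cases h1 : ∃ p ∈ σ, p.2 = false
  · by_cases h2 : ∃ p ∈ σ, p.2 = true
    · by_cases hvw : v + w ≤ n
      · rw [Nat.sub_eq_zero_of_le hvw]
        exact justified_zero hG _ d
      obtain ⟨p, hp, hp'⟩ := h1
      obtain ⟨p', hq, hq'⟩ := h2
      obtain ⟨X, r, N, hX, htX, hrX⟩ := hv
      obtain ⟨Y, s, L, hY, htY, hrY⟩ := hw
      refine ⟨_, _, _, hX.join hY (htX x ?_) (htY y ?_) hxy, fun u hu => ?_, by omega⟩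
      · exact List.mem_map.2 ⟨p, hp, by simp [hp']⟩
      · exact List.mem_map.2 ⟨p', hq, by simp [hq']⟩
      · obtain ⟨⟨u', b⟩, hz, rfl⟩ := List.mem_map.1 hu
        cases b
        · exact Or.inr (htY _ (List.mem_map.2 ⟨_, hz, by simp⟩))
        · exact Or.inl (htX _ (List.mem_map.2 ⟨_, hz, by simp⟩))
    · have : rightTuple y σ = wholeTuple σ := List.map_congr_left fun p hp => by
        have : p.2 ≠ true := fun h => h2 ⟨p, hp, h⟩
        simp [this]
      obtain ⟨X, r, N, hX, htX, hrX⟩ := hv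
      exact (this ▸ hw).anti (by omega)
  · have : leftTuple x σ = wholeTuple σ := List.map_congr_left fun p hp => by
      have : p.2 = true := by
        by_contra h
        exact h1 ⟨p, hp, by simpa using h⟩
      simp [this]
    obtain ⟨Y, s, L, hY, htY, hrY⟩ := hw
    exact (this ▸ hv).anti (by omega)

theorem Sound.raise {M : ℕ → ℕ} (h : Sound G ω k TB M) {t : List (Fin n)} (ht : t.length = k)
    {d : Fin c} {v : ℕ} (hv : Justified G ω t d v) :
    Sound G ω k TB (raise M (TB + tupleCode n c t + d) v) := by
  intro t' ht' d'
  by_cases he : TB + tupleCode n c t' + d' = TB + tupleCode n c t + d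
  · obtain ⟨rfl, hd⟩ := tupleCode_add_inj (ht'.trans ht.symm) d'.isLt d.isLt
      (by omega : tupleCode n c t' + d' = tupleCode n c t + d)
    obtain rfl := Fin.ext hd
    simp only [FloodIt.raise, Function.update_self]
    rcases Nat.le_total v (M (TB + tupleCode n c t' + d')) with hle | hle
    · exact (h t' ht' d').anti (by omega)
    · exact hv.anti (by omega)
  · rw [FloodIt.raise, Function.update_of_ne he]
    exact h t' ht' d'

theorem sound_keeps (hG : G.Connected) {σ : List (Fin n × Bool)} (hσ : σ.length = k)
    {x y : Fin n} (hxy : G.Adj x y) :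
    Keeps (Sound G ω k TB) n c (TB + tupleCode n c (wholeTuple σ))
      (TB + tupleCode n c (leftTuple x σ)) (TB + tupleCode n c (rightTuple y σ)) := by
  intro M hM d hd
  refine ⟨hM.raise (d := ⟨d, hd⟩) (by simp [wholeTuple, hσ]) (Justified.join hG hxy ?_ ?_),
    fun d' hd' => hM.raise (d := ⟨d, hd⟩) (by simp [wholeTuple, hσ]) ?_⟩
  · exact hM _ (by simp [leftTuple, hσ]) ⟨d, hd⟩
  · exact hM _ (by simp [rightTuple, hσ]) ⟨d, hd⟩
  · exact (hM _ (by simp [wholeTuple, hσ]) ⟨d', hd'⟩).recolour hG _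

/-- The last operation of an assembly is undone. Recolouring lowers `r` by one; in a join both parts
have a piece, so each is strictly smaller than the whole. The matching relaxation transfers the
bounds of the parts. -/
theorem Complete.step {M M' : ℕ → ℕ} {j : ℕ} {es : List (Fin n × Fin n)}
    (hes : ∀ x y, G.Adj x y → (x, y) ∈ es ∨ (y, x) ∈ es) (hne : 2 ≤ n → es ≠ [])
    (h : Complete G ω k TB j M) (hmono : ∀ a, M a ≤ M' a)
    (hrel : ∀ σ : List (Fin n × Bool), σ.length = k → ∀ e ∈ es, Relaxed n c
      (TB + tupleCode n c (wholeTuple σ)) (TB + tupleCode n c (leftTuple e.1 σ))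
      (TB + tupleCode n c (rightTuple e.2 σ)) M M') :
    Complete G ω k TB (j + 1) M' := by
  classical
  intro X d r N hB hr t ht htX
  cases hB with
  | single v =>
    have := h _ _ _ _ (.single v) (by omega) t ht htX
    have := hmono (TB + tupleCode n c t + (ω v))
    omega
  | @recolour _ d' r _ _ hB =>
    -- Past this case `n ≥ 2`, so there is an edge; recolourings are relaxed only while an edge is
    -- processed.
    by_cases hn : n ≤ r + 1
    · omega
    obtain ⟨e, he⟩ := List.exists_mem_of_ne_nil es (hne (by omega))
    have h1 := h _ _ _ _ hB (by omega) t ht htX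
    have h2 := (hrel (t.map fun u => (u, true)) (by simp [ht]) e he d d.isLt).2 d' d'.isLt
    have h3 : wholeTuple (t.map fun u => (u, true)) = t := by
      simp [wholeTuple, Function.comp_def]
    rw [h3] at h2
    omega
  | @join X₁ X₂ _ r₁ r₂ N₁ N₂ x y hX hY hx hy hxy =>
    have p1 := hX.pos
    have p2 := hY.pos
    -- Each edge is listed in one orientation only; exchanging the two parts suffices, since all
    -- markings are in the queue.
    wlog hmem : (x, y) ∈ es generalizing X₁ X₂ r₁ r₂ N₁ N₂ x y
    · have := this hy hx hxy.symm (fun u hu => Or.symm (htX u hu)) hY hX (by omega) p2 p1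
        ((hes x y hxy).resolve_left hmem)
      omega
    -- Mark the positions already covered by the first part; the second part covers the others.
    set σ : List (Fin n × Bool) := t.map fun u => (u, decide (u ∈ X₁)) with hσ
    have hw : wholeTuple σ = t := by simp [wholeTuple, hσ, Function.comp_def]
    have h1 := h _ _ _ _ hX (by omega) (leftTuple x σ) (by simp [leftTuple, hσ, ht])
      (fun u hu => by
        simp only [leftTuple, hσ, List.map_map, List.mem_map, Function.comp] at hu
        obtain ⟨w, hw, rfl⟩ := hu
        by_cases hwX : w ∈ X₁ <;> simp [hwX, hx])
    have h2 := h _ _ _ _ hY (by omega) (rightTuple y σ) (by simp [rightTuple, hσ, ht])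
      (fun u hu => by
        simp only [rightTuple, hσ, List.map_map, List.mem_map, Function.comp] at hu
        obtain ⟨w, hw, rfl⟩ := hu
        by_cases hwX : w ∈ X₁
        · simp [hwX, hy]
        · simpa [hwX] using (htX w hw).resolve_left hwX)
    have h3 := (hrel σ (by simp [hσ, ht]) (x, y) hmem d d.isLt).1
    rw [hw] at h3
    simp only at h3
    omega

theorem complete_zero {M : ℕ → ℕ}
    (hM : ∀ v : Fin n, M (TB + tupleCode n c (List.replicate k v) + ω v) = n) :
    Complete G ω k TB 0 M := by
  intro X d r N hB hr t ht htX
  cases hB with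
  | single v =>
    have : t = List.replicate k v := List.eq_replicate_iff.2 ⟨ht, fun u hu => htX u hu⟩
    rw [this, hM v, Nat.zero_add]
  | recolour d' hB =>
    have := hB.pos
    omega
  | join hX hY hx hy hxy =>
    have := hX.pos
    have := hY.pos
    omega

theorem sound_of_seed (hG : G.Connected) {M : ℕ → ℕ}
    (hM : ∀ a, TB ≤ a → M a = 0 ∨ M a = n ∧
      ∃ v : Fin n, a = TB + tupleCode n c (List.replicate k v) + ω v) :
    Sound G ω k TB M := by
  intro t ht d
  rcases hM (TB + tupleCode n c t + d) (by omega) with h0 | ⟨hn, v, hv⟩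
  · rw [h0]; exact justified_zero hG t d
  · obtain ⟨rfl, hd⟩ := tupleCode_add_inj (by simp [ht]) d.isLt (ω v).isLt
      (by omega : tupleCode n c t + d = tupleCode n c (List.replicate k v) + ω v)
    obtain rfl := Fin.ext hd
    exact ⟨{v}, 0, 1, .single v, fun u hu => List.eq_of_mem_replicate hu, by omega⟩

/-- The saving `v` is the right one for linking the vertices of `t` in colour `d`. -/
def Optimal (G : SimpleGraph (Fin n)) (ω : Fin n → Fin c) (t : List (Fin n)) (d : Fin c)
    (v : ℕ) : Prop :=
  Justified G ω t d v ∧ ∀ X r N, Build G ω X d r N → N ≤ n → (∀ u ∈ t, u ∈ X) → n ≤ r + v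

theorem optimal_of_table {M : ℕ → ℕ} (hs : Sound G ω k TB M)
    (hc : Complete G ω k TB (n + n) M) {t : List (Fin n)} (ht : t.length = k) (d : Fin c) :
    Optimal G ω t d (M (TB + tupleCode n c t + d)) := by
  refine ⟨hs t ht d, fun X r N hB hN htX => ?_⟩
  by_cases hr : n ≤ r
  · omega
  · exact hc X d r N hB (by omega) t ht htX

theorem Optimal.exists_play {t : List (Fin n)} {d : Fin c} {v : ℕ} (h : Optimal G ω t d v) :
    ∃ S : List (Fin n × Fin c), S.length ≤ n - v ∧ LinkedIn G (play G ω S) {u | u ∈ t} d := by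
  obtain ⟨⟨X, r, N, hB, htX, hr⟩, -⟩ := h
  obtain ⟨S, hS, hl⟩ := hB.exists_play
  exact ⟨S, by omega, hl.mono htX⟩

theorem Optimal.le_length {t : List (Fin n)} {d : Fin c} {v : ℕ} (h : Optimal G ω t d v)
    {S : List (Fin n × Fin c)} (hS : LinkedIn G (play G ω S) {u | u ∈ t} d) :
    n - v ≤ S.length := by
  obtain ⟨X, r, N, hX, hr, hN, hB⟩ := hS.exists_build
  have := h.2 X r N hB (by simpa using hN) hX
  omega

theorem Optimal.isLinkNumberIn {t : List (Fin n)} {d : Fin c} {v : ℕ}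
    (h : Optimal G ω t d v) : IsLinkNumberIn G ω {u | u ∈ t} d (n - v) := by
  constructor
  · obtain ⟨S, hS, hl⟩ := h.exists_play
    exact ⟨S, le_antisymm hS (h.le_length hl), hl⟩
  · rintro _ ⟨S, rfl, hl⟩
    exact h.le_length hl

theorem isLinkNumber_of_optimal {t : List (Fin n)} {f : Fin c → ℕ} {b : ℕ} {d₀ : Fin c}
    (h : ∀ d, Optimal G ω t d (f d)) (hle : ∀ d, f d ≤ b) (hb : b ≤ f d₀) :
    IsLinkNumber G ω {u | u ∈ t} (n - b) := by
  obtain rfl : b = f d₀ := le_antisymm hb (hle d₀)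
  constructor
  · obtain ⟨S, hS, hl⟩ := (h d₀).exists_play
    exact ⟨d₀, S, le_antisymm hS ((h d₀).le_length hl), hl⟩
  · rintro _ ⟨d, S, rfl, hl⟩
    have := (h d).le_length hl
    have := hle d
    omega

end Table

/-! ### Memory layout, seeding, and the complete solver. -/

section Solver

/-- The layout of an instance in the memory from address `b` on. -/
structure HoldsInput {n c : ℕ} (b : ℕ) (ω : Fin n → Fin c) (es : List (Fin n × Fin n))
    (us : List (Fin n)) (M : ℕ → ℕ) : Prop where
  order : M b = n
  size : M (b + 1) = es.length
  colours : M (b + 2) = c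
  targets : M (b + 3) = us.length
  colour : ∀ v : Fin n, M (b + 4 + c + v) = ω v
  edge : ∀ j (h : j < es.length), M (b + 4 + c + n + 2 * j) = (es[j]).1 ∧
    M (b + 4 + c + n + 2 * j + 1) = (es[j]).2
  target : ∀ j (h : j < us.length), M (b + 4 + c + n + 2 * es.length + j) = us[j]
  rest : ∀ a, b + 4 + c + n + 2 * es.length + us.length ≤ a → M a = 0

theorem length_flatMap_pair {α : Type*} (f g : α → ℕ) (l : List α) :
    (l.flatMap fun e => [f e, g e]).length = 2 * l.length := by
  induction l with
  | nil => rfl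
  | cons x l ih => simp only [List.flatMap_cons, List.length_append, ih, List.length_cons,
      List.length_nil]; ring

theorem getD_flatMap_pair {α : Type*} (f g : α → ℕ) (l : List α) (j : ℕ) (h : j < l.length) :
    (l.flatMap fun e => [f e, g e]).getD (2 * j) 0 = f l[j] ∧
      (l.flatMap fun e => [f e, g e]).getD (2 * j + 1) 0 = g l[j] := by
  induction l generalizing j with
  | nil => simp at h
  | cons x l ih =>
    cases j with
    | zero => simp
    | succ j => simpa [Nat.mul_succ] using ih j (by simpa using h)

theorem getD_append_add {α : Type*} (l l' : List α) (d : α) {i j : ℕ} (h : j = l.length + i) :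
    (l ++ l').getD j d = l'.getD i d := by
  subst h
  rw [List.getD_append_right _ _ _ _ (Nat.le_add_right _ _), Nat.add_sub_cancel_left]

theorem holdsInput {n c : ℕ} (pre : List ℕ) (ω : Fin n → Fin c) (es : List (Fin n × Fin n))
    (us : List (Fin n)) :
    HoldsInput pre.length ω es us (ramInit (pre ++ instanceWords ω es us)).mem := by
  have hle := length_flatMap_pair (fun e : Fin n × Fin n => (e.1 : ℕ)) (fun e => (e.2 : ℕ)) es
  have hassoc : instanceWords ω es us = [n, es.length, c, us.length] ++ (List.range c ++
      (List.ofFn (fun v => (ω v : ℕ)) ++ (es.flatMap (fun e => [(e.1 : ℕ), (e.2 : ℕ)]) ++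
      us.map Fin.val))) := by
    simp only [instanceWords, List.append_assoc, List.pure_def, List.bind_eq_flatMap,
      List.map_eq_flatMap, List.flatMap_singleton']
  simp only [ramInit, hassoc]
  refine ⟨?_, ?_, ?_, ?_, fun v => ?_, fun j h => ?_, fun j h => ?_, fun a ha => ?_⟩
  · rw [getD_append_add _ _ _ (i := 0) (by omega)]; rfl
  · rw [getD_append_add _ _ _ (i := 1) (by omega)]; rfl
  · rw [getD_append_add _ _ _ (i := 2) (by omega)]; rfl
  · rw [getD_append_add _ _ _ (i := 3) (by omega)]; rfl
  · rw [getD_append_add _ _ _ (i := 4 + c + v) (by omega),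
      getD_append_add _ _ _ (i := c + v) (by simp only [List.length_cons, List.length_nil]; omega),
      getD_append_add _ _ _ (i := v) (by simp), List.getD_append _ _ _ _ (by simp)]
    simp
  · obtain ⟨h1, h2⟩ := getD_flatMap_pair (fun e : Fin n × Fin n => (e.1 : ℕ))
      (fun e => (e.2 : ℕ)) es j h
    constructor
    · rw [getD_append_add _ _ _ (i := 4 + c + n + 2 * j) (by omega),
        getD_append_add _ _ _ (i := c + n + 2 * j)
          (by simp only [List.length_cons, List.length_nil]; omega),
        getD_append_add _ _ _ (i := n + 2 * j) (by simp only [List.length_range]; omega),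
        getD_append_add _ _ _ (i := 2 * j) (by simp), List.getD_append _ _ _ _ (by omega), h1]
    · rw [getD_append_add _ _ _ (i := 4 + c + n + 2 * j + 1) (by omega),
        getD_append_add _ _ _ (i := c + n + 2 * j + 1)
          (by simp only [List.length_cons, List.length_nil]; omega),
        getD_append_add _ _ _ (i := n + 2 * j + 1) (by simp only [List.length_range]; omega),
        getD_append_add _ _ _ (i := 2 * j + 1) (by simp only [List.length_ofFn]; omega),
        List.getD_append _ _ _ _ (by omega), h2]
  · rw [getD_append_add _ _ _ (i := 4 + c + n + 2 * es.length + j) (by omega),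
      getD_append_add _ _ _ (i := c + n + 2 * es.length + j)
        (by simp only [List.length_cons, List.length_nil]; omega),
      getD_append_add _ _ _ (i := n + 2 * es.length + j)
        (by simp only [List.length_range]; omega),
      getD_append_add _ _ _ (i := 2 * es.length + j) (by simp only [List.length_ofFn]; omega),
      getD_append_add _ _ _ (i := j) (by omega),
      List.getD_eq_getElem _ _ (by simpa using h), List.getElem_map]
  · refine List.getD_eq_default _ _ ?_
    simp only [List.length_append, List.length_cons, List.length_nil, List.length_range,
      List.length_ofFn, List.length_map, hle]
    omega

/-- Read the sizes and compute the addresses, for an instance that starts at address `b`. -/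
def setup (b : ℕ) : RamProg :=
  .seq (.assign 1 (.cell (.num b))) <|
  .seq (.assign 2 (.cell (.num (b + 1)))) <|
  .seq (.assign 3 (.cell (.num (b + 2)))) <|
  .seq (.assign 4 (.cell (.num (b + 3)))) <|
  .seq (.assign 5 (.add (.num (b + 4)) (.reg 3))) <|
  .seq (.assign 6 (.add (.reg 5) (.reg 1))) <|
  .seq (.assign 7 (.add (.reg 6) (.add (.reg 2) (.reg 2)))) <|
  .seq (.assign 8 (.add (.reg 7) (.reg 4))) <|
  .seq (.assign 9 (.add (.reg 8) (.num 3))) <|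
  .assign 10 (.reg 3)

/-- The registers after the setup. -/
structure SetUp {n c : ℕ} (b : ℕ) (es : List (Fin n × Fin n)) (us : List (Fin n))
    (s : RamState) : Prop where
  order : s.reg 1 = n
  colours : s.reg 3 = c
  targets : s.reg 4 = us.length
  colour : s.reg 5 = b + 4 + c
  edge : s.reg 6 = b + 4 + c + n
  target : s.reg 7 = b + 4 + c + n + 2 * es.length
  queue : s.reg 8 = b + 4 + c + n + 2 * es.length + us.length

theorem setup_runs {n c b : ℕ} {ω : Fin n → Fin c} {es : List (Fin n × Fin n)}
    {us : List (Fin n)} {s : RamState} (hr : ∀ i, s.reg i = 0)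
    (hs : HoldsInput b ω es us s.mem) :
    Runs (setup b) s 60 fun s' => s'.mem = s.mem ∧ SetUp (c := c) b es us s' ∧
      Generated n c us s' 0 s' := by
  refine .straight ⟨trivial, trivial, trivial, trivial, trivial, trivial, trivial, trivial,
    trivial, trivial⟩ (by simp [setup, RamProg.time, RamExpr.cost]) ?_
  have e1 := hs.order
  have e2 := hs.size
  have e3 := hs.colours
  have e4 := hs.targets
  have hset : SetUp (c := c) b es us ((setup b).step s) := by
    constructor <;> simp [setup, RamProg.step, RamExpr.eval, e1, e2, e3, e4] <;> ring
  have hmem : ((setup b).step s).mem = s.mem := rfl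
  have hzero : ∀ a, b + 4 + c + n + 2 * es.length + us.length ≤ a →
      ((setup b).step s).mem a = 0 := hs.rest
  refine ⟨hmem, hset, fun _ _ => rfl, ?_, ?_, ?_, ?_, ?_, le_rfl, fun _ _ => rfl,
    fun a ha => hzero a ?_, ?_⟩
  · simp [setup, RamProg.step, RamExpr.eval, e3]
  · simp [setup, RamProg.step, hr, code_nil]
  · simp [setup, RamProg.step, hr, code_nil]
  · simp [setup, RamProg.step, hr]
  · simp [setup, RamProg.step, RamExpr.eval]
  · have : ((setup b).step s).reg 9 = ((setup b).step s).reg 8 + 3 := by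
      simp [setup, RamProg.step, RamExpr.eval]
    rw [this, hset.queue] at ha
    omega
  · have hentry : IsEntry (n := n) c ((setup b).step s).mem
        (((setup b).step s).reg 8 + 3 * 0) [] := by
      refine ⟨?_, ?_, ?_⟩ <;> rw [code_nil] <;> apply hzero <;> rw [hset.queue] <;> omega
    refine ⟨fun q hq => ⟨[], rfl, ?_⟩, fun σ hσ => ⟨0, by simp, ?_⟩⟩
    · obtain rfl : q = 0 := by simpa using hq
      exact hentry
    · obtain rfl := List.length_eq_zero_iff.1 hσ
      exact hentry

/-- Enter the saving of a single vertex in its own colour. -/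
def seedVertex : RamProg :=
  .seq (.seq (.assign 17 (.reg 9)) (.assign 18 (.reg 13))) <|
  .seq (mulAdd 17 18 11) <|
  .seq (.store (.add (.reg 17) (.cell (.add (.reg 5) (.reg 13)))) (.reg 1))
    (.assign 13 (.add (.reg 13) (.num 1)))

def seed : RamProg :=
  .seq (.assign 13 (.num 0)) (.loop (.sub (.reg 1) (.reg 13)) seedVertex)

theorem seedVertex_runs {s : RamState} {n : ℕ} (h1 : s.reg 1 = n) (hn : s.reg 13 < n) :
    Runs seedVertex s (n * 10 + 18) fun s' =>
      (∀ i < 13, s'.reg i = s.reg i) ∧ s'.reg 13 = s.reg 13 + 1 ∧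
      s'.mem = Function.update s.mem
        (s.reg 9 + s.reg 13 * s.reg 11 + s.mem (s.reg 5 + s.reg 13)) n := by
  unfold seedVertex
  refine Runs.seq (.straight ⟨trivial, trivial⟩ (le_refl 4) rfl) (T₂ := n * 10 + 14) ?_ (by omega)
  rintro _ rfl
  refine Runs.seq (mulAdd_runs (T := n * 10 + 2) (by decide) (by decide) (by decide) _
    (by simp [RamProg.step, RamExpr.eval]; omega)) (T₂ := 12) ?_ (by omega)
  rintro _ rfl
  refine .straight ⟨trivial, trivial⟩ (by decide) ⟨fun i hi => ?_, ?_, ?_⟩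
  · simp [RamProg.step, hi.ne, show i ≠ 17 by omega, show i ≠ 18 by omega]
  · simp [RamProg.step, RamExpr.eval]
  · simp [RamProg.step, RamExpr.eval, h1]

theorem seed_runs {s : RamState} {n c : ℕ} {w : Fin n → Fin c} (h1 : s.reg 1 = n)
    (h5 : s.reg 5 + n ≤ s.reg 9) (hw : ∀ v : Fin n, s.mem (s.reg 5 + v) = w v) :
    Runs seed s (n * (n * 10 + 22) + 6) fun s' =>
      (∀ i < 13, s'.reg i = s.reg i) ∧ (∀ a < s.reg 9, s'.mem a = s.mem a) ∧
      (∀ v : Fin n, s'.mem (s.reg 9 + v * s.reg 11 + w v) = n) ∧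
      ∀ a, s'.mem a = s.mem a ∨ s'.mem a = n ∧ ∃ v : Fin n, a = s.reg 9 + v * s.reg 11 + w v := by
  refine Runs.seq (.straight trivial (le_refl 2) rfl) (T₂ := n * (n * 10 + 22) + 4) ?_ (by omega)
  rintro _ rfl
  refine Runs.loop (N := n) (B := n * 10 + 18) (fun j s' =>
      (∀ i < 13, s'.reg i = s.reg i) ∧ s'.reg 13 = j ∧ (∀ a < s.reg 9, s'.mem a = s.mem a) ∧
      (∀ v : Fin n, v < j → s'.mem (s.reg 9 + v * s.reg 11 + w v) = n) ∧
      ∀ a, s'.mem a = s.mem a ∨ s'.mem a = n ∧ ∃ v : Fin n, a = s.reg 9 + v * s.reg 11 + w v)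
      ?_ ?_ ?_ ?_
  · refine ⟨fun i hi => ?_, ?_, fun _ _ => rfl, fun v hv => absurd hv (Nat.not_lt_zero _),
      fun a => Or.inl rfl⟩
    · simp [RamProg.step, hi.ne]
    · simp [RamProg.step, RamExpr.eval]
  · rintro j hj s₁ ⟨hf, h13, hlo, hn, hall⟩
    have e1 : s₁.reg 1 = n := (hf 1 (by decide)).trans h1
    refine ⟨by simp only [RamExpr.eval]; omega,
      (seedVertex_runs e1 (by omega)).mono le_rfl ?_⟩
    rintro s₂ ⟨hf₂, h13₂, hm₂⟩
    rw [hf 9 (by decide), hf 11 (by decide), hf 5 (by decide), h13,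
      hlo _ (by omega), hw ⟨j, hj⟩] at hm₂
    refine ⟨fun i hi => (hf₂ i hi).trans (hf i hi), by omega, fun a ha => ?_, fun v hv => ?_,
      fun a => ?_⟩
    · rw [hm₂, Function.update_of_ne (by omega), hlo a ha]
    -- Seed addresses may coincide, as for equally coloured vertices when `k = 0`; the value written
    -- is `n` in each case.
    · by_cases hv' : s.reg 9 + v * s.reg 11 + w v = s.reg 9 + j * s.reg 11 + w ⟨j, hj⟩
      · rw [hm₂, hv', Function.update_self]
      · have hvj : (v : ℕ) < j := by
          have : (v : ℕ) ≠ j := by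
            rintro rfl
            exact hv' rfl
          omega
        rw [hm₂, Function.update_of_ne hv', hn v hvj]
    · by_cases ha : a = s.reg 9 + j * s.reg 11 + w ⟨j, hj⟩
      · right
        refine ⟨?_, ⟨j, hj⟩, ha⟩
        rw [hm₂, ha, Function.update_self]
      · rw [hm₂, Function.update_of_ne ha]
        exact hall a
  · rintro s₁ ⟨hf, h13, hlo, hn, hall⟩
    refine ⟨?_, hf, hlo, fun v => hn v v.isLt, hall⟩
    simp only [RamExpr.eval, hf 1 (by decide)]
    omega
  · simp only [RamExpr.cost]
    rw [show n * 10 + 22 = 1 + 1 + 1 + 1 + (n * 10 + 18) by omega]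

/-- Fill the table. -/
def solve (b : ℕ) : RamProg :=
  .seq (setup b) <| .seq generate <| .seq seed relaxAll

/-- A bound for the running time of `solve`. -/
def solveTime (n m c k : ℕ) : ℕ :=
  60 + (k * ((2 * n) ^ k * (n * 102 + 24) + n * 20 + 44) + 4) + (n * (n * 10 + 22) + 6) +
    ((n + n) * ((2 * n) ^ k * (m * (c * (c * 32 + 44) + n * 20 + 54) + 30) + 12) + 6)

theorem solve_runs {n c b : ℕ} {G : SimpleGraph (Fin n)} (hG : G.Connected)
    {ω : Fin n → Fin c} {es : List (Fin n × Fin n)} {us : List (Fin n)}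
    (hes : ∀ x y, G.Adj x y ↔ (x, y) ∈ es ∨ (y, x) ∈ es) {s : RamState}
    (hr : ∀ i, s.reg i = 0) (hs : HoldsInput b ω es us s.mem) :
    Runs (solve b) s (solveTime n es.length c us.length) fun s' =>
      s'.reg 1 = n ∧ s'.reg 3 = c ∧ (∀ a < b, s'.mem a = s.mem a) ∧
      ∀ d : Fin c, Optimal G ω us d (s'.mem (s'.reg 9 + s'.reg 12 + d)) := by
  obtain ⟨v₀⟩ := hG.nonempty
  have hn : 0 < n := v₀.pos
  refine Runs.seq (setup_runs hr hs) (T₂ := (us.length * ((2 * n) ^ us.length * (n * 102 + 24) + n * 20 + 44) + 4)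
    + ((n * (n * 10 + 22) + 6) +
    ((n + n) * ((2 * n) ^ us.length * (es.length * (c * (c * 32 + 44) + n * 20 + 54) + 30) + 12) + 6)))
    ?_ (by rw [solveTime]; omega)
  rintro s₁ ⟨hm₁, hset, hgen⟩
  have hin : HoldsInput b ω es us s₁.mem := hm₁ ▸ hs
  refine Runs.seq (generate_runs hn hset.order hset.targets (by rw [hset.target, hset.queue])
    (fun j hj => by rw [hset.target]; exact hin.target j hj) hgen) ?_ le_rfl
  intro s₂ h₂
  have htail := h₂.tail
  have hhead := h₂.head
  rw [hset.queue] at hhead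
  have hones : s₂.reg 11 = code n c (fun _ => 1) us := by rw [h₂.ones, List.take_length]
  have hrep : ∀ v : Fin n, s₂.reg 9 + v * s₂.reg 11 + ω v =
      s₂.reg 9 + tupleCode n c (List.replicate us.length v) + ω v := fun v => by
    rw [hones, tupleCode_replicate n c us.length v rfl]
  have hlow : ∀ a < b + 4 + c + n + 2 * es.length + us.length, s₂.mem a = s₁.mem a :=
    fun a ha => h₂.low a (by rw [hset.queue]; exact ha)
  refine Runs.seq (seed_runs (w := ω) ((h₂.reg 1 (by decide)).trans hset.order) ?_ (fun v => ?_)) ?_ le_rfl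
  · rw [h₂.reg 5 (by decide), hset.colour]; omega
  · rw [h₂.reg 5 (by decide), hset.colour, hlow _ (by omega), hin.colour v]
  rintro s₃ ⟨hf₃, hlo₃, hseed, hall⟩
  have hhigh : ∀ a, s₂.reg 9 ≤ a → s₂.mem a = 0 := h₂.high
  simp only [hrep] at hseed hall
  set H := s₂.reg 8 with hH
  set TB := s₂.reg 9 with hTB
  have hready : Ready n es.length c H ((2 * n) ^ us.length) (b + 4 + c + n) (code n c (fun _ => 1) us)
      s₃ := by
    constructor
    · rw [hf₃ 1 (by decide), h₂.reg 1 (by decide), hset.order]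
    · rw [hf₃ 3 (by decide), h₂.reg 3 (by decide), hset.colours]
    · rw [hf₃ 6 (by decide), h₂.reg 6 (by decide), hset.edge]
    · rw [hf₃ 7 (by decide), h₂.reg 7 (by decide), hset.target]
    · rw [hf₃ 8 (by decide)]
    · rw [hf₃ 9 (by decide), ← htail]
    · rw [hf₃ 11 (by decide), hones]
    · omega
    · intro j hj
      rw [hlo₃ _ (by omega), hlo₃ _ (by omega), hlow _ (by omega), hlow _ (by omega),
        (hin.edge j hj).1, (hin.edge j hj).2]
      exact ⟨(es[j]).1.isLt.le, (es[j]).2.isLt.le⟩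
  have hedge : ∀ j (hj : j < es.length), s₃.mem (b + 4 + c + n + 2 * j) = (es[j]).1 ∧
      s₃.mem (b + 4 + c + n + 2 * j + 1) = (es[j]).2 := fun j hj => by
    rw [hlo₃ _ (by omega), hlo₃ _ (by omega), hlow _ (by omega), hlow _ (by omega)]
    exact hin.edge j hj
  have hentry : ∀ q < (2 * n) ^ us.length, ∀ σ : List (Fin n × Bool), IsEntry c s₂.mem (H + 3 * q) σ →
      IsEntry c s₃.mem (H + 3 * q) σ := fun q hq σ hσ => by
    rw [IsEntry, hlo₃ _ (by omega), hlo₃ _ (by omega), hlo₃ _ (by omega)]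
    exact hσ
  have hsound : Sound G ω us.length TB s₃.mem := sound_of_seed hG fun a ha => by
    rcases hall a with h0 | h0
    · exact Or.inl (h0.trans (hhigh a ha))
    · exact Or.inr h0
  refine (relaxAll_runs (P := Sound G ω us.length TB) (Φ := Complete G ω us.length TB) hready ?_ hsound
    (complete_zero hseed) ?_).mono le_rfl ?_
  · intro q hq j hj
    obtain ⟨σ, hσk, hσ⟩ := h₂.queue.1 q hq
    have hσ' := hentry q hq σ hσ
    rw [← htail, hσ'.whole, hσ'.leftAddr_eq (hedge j hj).1 hσk,
      hσ'.rightAddr_eq (hedge j hj).2]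
    exact sound_keeps hG hσk ((hes _ _).2 (Or.inl (List.getElem_mem hj)))
  · intro i M M' hM hadv hrel
    refine hM.step (fun x y => (hes x y).1) (fun h2 => ?_) hadv.mono fun σ hσk e he => ?_
    · obtain ⟨w, hw⟩ : ∃ w : Fin n, G.Adj v₀ w := by
        have : Nontrivial (Fin n) := Fin.nontrivial_iff_two_le.2 h2
        exact hG.preconnected.exists_adj_of_nontrivial v₀
      rcases (hes _ _).1 hw with h | h <;> exact List.ne_nil_of_mem h
    · obtain ⟨q, hq, hσ⟩ := h₂.queue.2 σ hσk
      obtain ⟨j, hj, rfl⟩ := List.mem_iff_getElem.1 he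
      have hσ' := hentry q hq σ hσ
      have := hrel q hq j hj
      rwa [← htail, hσ'.whole, hσ'.leftAddr_eq (hedge j hj).1 hσk,
        hσ'.rightAddr_eq (hedge j hj).2] at this
  · rintro s₄ ⟨hf₄, hlo₄, hs₄, hc₄⟩
    refine ⟨by rw [hf₄ 1 (by decide), hready.order], by rw [hf₄ 3 (by decide), hready.colours],
      fun a ha => ?_, fun d => ?_⟩
    · rw [hlo₄ a (by omega), hlo₃ a (by omega), hlow a (by omega), hm₁]
    · rw [hf₄ 9 (by decide), hf₄ 12 (by decide), hf₃ 9 (by decide), hf₃ 12 (by decide),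
        h₂.target, List.take_length]
      exact optimal_of_table hs₄ hc₄ rfl d

end Solver

/-! ### Output programs and running time. -/

section Output

/-- Solve an instance and output the number of moves for the colour at address `0`. -/
def solveColour : RamProg :=
  .seq (solve 1) (.assign 0 (.sub (.reg 1) (.cell (.add (.add (.reg 9) (.reg 12))
    (.cell (.num 0))))))

def bestColourStep : RamProg :=
  .seq (.assign 22 (.sub (.reg 22) (.num 1)))
    (.assign 23 (.add (.reg 23) (.sub (.cell (.add (.add (.reg 9) (.reg 12)) (.reg 22)))
      (.reg 23))))

/-- Output the number of moves for the best colour. -/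
def bestColour : RamProg :=
  .seq (.seq (.assign 22 (.reg 3)) (.assign 23 (.num 0))) <|
  .seq (.loop (.reg 22) bestColourStep) (.assign 0 (.sub (.reg 1) (.reg 23)))

def solveBest : RamProg := .seq (solve 0) bestColour

theorem solveColour_runs {n c : ℕ} {G : SimpleGraph (Fin n)} (hG : G.Connected)
    {ω : Fin n → Fin c} {es : List (Fin n × Fin n)} {us : List (Fin n)}
    (hes : ∀ x y, G.Adj x y ↔ (x, y) ∈ es ∨ (y, x) ∈ es) (d : Fin c) :
    ∃ v, Optimal G ω us d v ∧ RamComputesWithin solveColour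
      ((d : ℕ) :: instanceWords ω es us) (n - v) (solveTime n es.length c us.length + 10) := by
  obtain ⟨t, s, ht, hex, h1, -, hlow, hopt⟩ := solve_runs (b := 1) hG hes (fun _ => rfl)
    (holdsInput [(d : ℕ)] ω es us)
  refine ⟨_, hopt d, _, _, ?_, hex.seq (.assign 0 _ s), ?_⟩
  · simp only [RamExpr.cost]; omega
  · have h0 : s.mem 0 = d := hlow 0 Nat.one_pos
    simp [RamExpr.eval, h0, h1]

theorem bestColour_runs {s : RamState} {n c : ℕ} {f : Fin c → ℕ} (hc : 0 < c)
    (h1 : s.reg 1 = n) (h3 : s.reg 3 = c)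
    (hf : ∀ d : Fin c, s.mem (s.reg 9 + s.reg 12 + d) = f d) :
    Runs bestColour s (c * 18 + 20) fun s' =>
      ∃ b d₀, (∀ d, f d ≤ b) ∧ b ≤ f d₀ ∧ s'.reg 0 = n - b := by
  refine Runs.seq (.straight ⟨trivial, trivial⟩ (le_refl 4) rfl) (T₂ := c * 18 + 6) ?_ (by omega)
  rintro _ rfl
  refine Runs.seq (T₁ := c * 18 + 2) (T₂ := 4) (R := fun s' => s'.reg 1 = n ∧
    (∀ d, f d ≤ s'.reg 23) ∧ ∃ d₀, s'.reg 23 ≤ f d₀) ?_ ?_ (by omega)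
  · refine Runs.loop (N := c) (B := 16) (fun j s' => (∀ i < 22, s'.reg i = s.reg i) ∧
      s'.mem = s.mem ∧ s'.reg 22 = c - j ∧ (∀ d : Fin c, c - j ≤ d → f d ≤ s'.reg 23) ∧
      ∃ d₀, s'.reg 23 ≤ f d₀) ?_ ?_ ?_ ?_
    · refine ⟨fun i hi => ?_, rfl, ?_, fun d hd => by omega, ⟨0, hc⟩, ?_⟩
      · simp [RamProg.step, hi.ne, show i ≠ 23 by omega]
      all_goals simp [RamProg.step, RamExpr.eval, h3]
    · rintro j hj s₁ ⟨hr, hm, h22, hle, d₀, hd₀⟩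
      refine ⟨by simp only [RamExpr.eval]; omega, .straight ⟨trivial, trivial⟩ (by decide) ?_⟩
      have hv : s.mem (s.reg 9 + s.reg 12 + (c - (j + 1))) = f ⟨c - (j + 1), by omega⟩ :=
        hf ⟨c - (j + 1), by omega⟩
      have h23 : (bestColourStep.step s₁).reg 23 =
          s₁.reg 23 + (f ⟨c - (j + 1), by omega⟩ - s₁.reg 23) := by
        rw [← hv]
        simp [bestColourStep, RamProg.step, RamExpr.eval, hr, hm, h22, Nat.sub_sub]
      refine ⟨fun i hi => ?_, hm, ?_, fun d hd => ?_, ?_⟩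
      · simp [bestColourStep, RamProg.step, hi.ne, show i ≠ 23 by omega, hr i hi]
      · simp [bestColourStep, RamProg.step, RamExpr.eval, h22, Nat.sub_sub]
      · rw [h23]
        by_cases hd' : c - j ≤ d
        · have := hle d hd'
          omega
        · have hd₁ : d = ⟨c - (j + 1), by omega⟩ := Fin.ext (by simp only; omega)
          rw [hd₁]
          omega
      · rw [h23]
        rcases Nat.le_total (f ⟨c - (j + 1), by omega⟩) (s₁.reg 23) with h | h
        · exact ⟨d₀, by omega⟩
        · exact ⟨⟨c - (j + 1), by omega⟩, by omega⟩
    · rintro s₁ ⟨hr, hm, h22, hle, hd₀⟩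
      refine ⟨by simp only [RamExpr.eval]; omega, by rw [hr 1 (by decide), h1],
        fun d => hle d (by omega), hd₀⟩
    · simp only [RamExpr.cost]; omega
  · rintro s₁ ⟨h1', hle, d₀, hd₀⟩
    refine .straight trivial (by decide) ⟨s₁.reg 23, d₀, hle, hd₀, ?_⟩
    simp [RamProg.step, RamExpr.eval, h1']

theorem solveBest_runs {n c : ℕ} {G : SimpleGraph (Fin n)} (hG : G.Connected)
    {ω : Fin n → Fin c} {es : List (Fin n × Fin n)} {us : List (Fin n)}
    (hes : ∀ x y, G.Adj x y ↔ (x, y) ∈ es ∨ (y, x) ∈ es) :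
    ∃ r, IsLinkNumber G ω {u | u ∈ us} r ∧ RamComputesWithin solveBest
      (instanceWords ω es us) r (solveTime n es.length c us.length + (c * 18 + 20)) := by
  have hc : 0 < c := by
    obtain ⟨v⟩ := hG.nonempty
    exact (ω v).pos
  have hrun : Runs solveBest (ramInit (instanceWords ω es us))
      (solveTime n es.length c us.length + (c * 18 + 20))
      fun s => IsLinkNumber G ω {u | u ∈ us} (s.reg 0) := by
    refine Runs.seq (solve_runs (b := 0) hG hes (fun _ => rfl) (holdsInput [] ω es us)) ?_ le_rfl
    rintro s ⟨h1, h3, -, hopt⟩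
    refine (bestColour_runs hc h1 h3 fun d => rfl).mono le_rfl ?_
    rintro s' ⟨b, d₀, hle, hb, h0⟩
    rw [h0]
    exact isLinkNumber_of_optimal hopt hle hb
  obtain ⟨t, s, ht, hex, hlink⟩ := hrun
  exact ⟨_, hlink, t, s, ht, hex, rfl⟩

theorem ListsEdges.adj_iff {n : ℕ} {G : SimpleGraph (Fin n)} {es : List (Fin n × Fin n)}
    (h : ListsEdges G es) (x y : Fin n) : G.Adj x y ↔ (x, y) ∈ es ∨ (y, x) ∈ es := by
  rw [← SimpleGraph.mem_edgeSet, ← h.2, List.mem_map]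
  constructor
  · rintro ⟨⟨a, b⟩, he, hab⟩
    rcases Sym2.eq_iff.1 hab with ⟨rfl, rfl⟩ | ⟨rfl, rfl⟩
    · exact Or.inl he
    · exact Or.inr he
  · rintro (he | he)
    · exact ⟨_, he, rfl⟩
    · exact ⟨_, he, Sym2.eq_swap⟩

theorem ListsEdges.length_eq {n : ℕ} {G : SimpleGraph (Fin n)} {es : List (Fin n × Fin n)}
    (h : ListsEdges G es) : es.length = G.edgeSet.ncard := by
  classical
  have : G.edgeSet = ((es.map fun e => s(e.1, e.2)).toFinset : Set (Sym2 (Fin n))) := by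
    ext x
    rw [Finset.mem_coe, List.mem_toFinset, h.2]
  rw [this, Set.ncard_coe_finset, List.toFinset_card_of_nodup h.1, List.length_map]

theorem ListsVertices.coe_eq {n : ℕ} {U : Finset (Fin n)} {us : List (Fin n)}
    (h : ListsVertices U us) : {u | u ∈ us} = (U : Set (Fin n)) := by
  ext x
  exact h.2 x

theorem ListsVertices.length_eq {n : ℕ} {U : Finset (Fin n)} {us : List (Fin n)}
    (h : ListsVertices U us) : us.length = U.card := by
  classical
  have : U = us.toFinset := by
    ext x
    rw [List.mem_toFinset, h.2]
  rw [this, List.toFinset_card_of_nodup h.1]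

/-- Here `Z` is the queue length, `B` the cost of one entry in a round, and `w` stands for `m * c ^
2 * n`. Generation and seeding are dominated by the relaxation bound. -/
theorem time_sum_le {n k Z B w : ℕ} (hn : 0 < n) (hZ : 0 < Z) (hmq : 0 < w) (hk : k ≤ n)
    (h6 : B ≤ 180 * w) : 60 + (k * (Z * (n * 102 + 24) + n * 20 + 44) + 4) +
      (n * (n * 10 + 22) + 6) + ((n + n) * (Z * B + 12) + 6) ≤
        2000 * (n * (Z * (n * w)) + 1) := by
  have h7 : (n + n) * (Z * B + 12) ≤ 400 * (n * (Z * (n * w))) := by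
    have e1 : Z * B ≤ Z * (180 * w) := Nat.mul_le_mul_left _ h6
    have e2 : w ≤ n * w := Nat.le_mul_of_pos_left _ hn
    have e3 : Z * w ≤ Z * (n * w) := Nat.mul_le_mul_left _ e2
    have e4 : 0 < Z * (n * w) := by positivity
    have e5 : Z * B + 12 ≤ 192 * (Z * (n * w)) := by
      rw [show Z * (180 * w) = 180 * (Z * w) by ring] at e1
      omega
    have e6 := Nat.mul_le_mul_left (n + n) e5
    rw [show (n + n) * (192 * (Z * (n * w))) = 384 * (n * (Z * (n * w))) by ring] at e6
    omega
  have h8 : n ≤ n * w := Nat.le_mul_of_pos_right _ hmq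
  have h9 : n * w ≤ Z * (n * w) := Nat.le_mul_of_pos_left _ hZ
  have h10 : n * n ≤ n * (Z * (n * w)) := Nat.mul_le_mul_left _ (h8.trans h9)
  have h11 : n * (Z * n) ≤ n * (Z * (n * w)) :=
    Nat.mul_le_mul_left _ (Nat.mul_le_mul_left _ h8)
  have h12 : k * (Z * (n * 102 + 24) + n * 20 + 44) ≤ 200 * (n * (Z * (n * w))) := by
    have e1 : Z ≤ Z * n := Nat.le_mul_of_pos_right _ hn
    have e2 : n ≤ Z * n := Nat.le_mul_of_pos_left _ hZ
    have e3 : Z * (n * 102 + 24) + n * 20 + 44 ≤ 200 * (Z * n) := by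
      rw [show Z * (n * 102 + 24) = 102 * (Z * n) + 24 * Z by ring]
      omega
    have e4 := Nat.mul_le_mul hk e3
    rw [show n * (200 * (Z * n)) = 200 * (n * (Z * n)) by ring] at e4
    omega
  have h13 : n ≤ n * n := Nat.le_mul_of_pos_right _ hn
  rw [show n * (n * 10 + 22) = 10 * (n * n) + 22 * n by ring]
  omega

/-- There are `2 * n` rounds over `(2 * n) ^ k` entries and `m` edges, each edge costing a multiple
of `c ^ 2 + n`, where `n` pays for the multiplications. For `n = 1` there are no edges and `k ≤ 1`,
so the time is constant, whatever `c` is. -/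
theorem solveTime_le {n m c k : ℕ} (hn : 0 < n) (hc : 0 < c) (hk : k ≤ n)
    (hm : 2 ≤ n → 0 < m) (hm' : n = 1 → m = 0) :
    solveTime n m c k ≤ 2000 * (n ^ (k + 3) * m * c ^ 2 * 2 ^ k + 1) := by
  rcases Nat.lt_or_ge n 2 with h | h
  · obtain rfl : n = 1 := by omega
    obtain rfl := hm' rfl
    interval_cases k <;> simp [solveTime]
  · have hm := hm h
    rw [show n ^ (k + 3) * m * c ^ 2 * 2 ^ k = n * ((2 * n) ^ k * (n * (m * (c * (c * n))))) by
      rw [Nat.mul_pow, Nat.pow_add]; ring, solveTime]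
    have hZ : 0 < (2 * n) ^ k := Nat.pow_pos (by omega)
    have hq : 0 < c * (c * n) := by positivity
    have h1 : c * c ≤ c * (c * n) := Nat.mul_le_mul_left _ (Nat.le_mul_of_pos_right _ hn)
    have h2 : c ≤ c * c := Nat.le_mul_of_pos_right _ hc
    have h3 : n ≤ c * (c * n) := (Nat.le_mul_of_pos_left _ hc).trans (Nat.le_mul_of_pos_left _ hc)
    have h4 : c * (c * 32 + 44) + n * 20 + 54 ≤ 150 * (c * (c * n)) := by
      rw [show c * (c * 32 + 44) = 32 * (c * c) + 44 * c by ring]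
      omega
    have hmq : 0 < m * (c * (c * n)) := by positivity
    have h5 := Nat.mul_le_mul_left m h4
    rw [show m * (150 * (c * (c * n))) = 150 * (m * (c * (c * n))) by ring] at h5
    have h6 : m * (c * (c * 32 + 44) + n * 20 + 54) + 30 ≤ 180 * (m * (c * (c * n))) := by
      refine (Nat.add_le_add_right h5 30).trans ?_
      generalize m * (c * (c * n)) = w at hmq ⊢
      omega
    exact time_sum_le hn hZ hmq hk h6

theorem solveTime_le_of_lists {n c : ℕ} {G : SimpleGraph (Fin n)} (hG : G.Connected) (d : Fin c)
    {U : Finset (Fin n)} {es : List (Fin n × Fin n)} {us : List (Fin n)} (hes : ListsEdges G es)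
    (hus : ListsVertices U us) : solveTime n es.length c us.length ≤
      2000 * (n ^ (U.card + 3) * G.edgeSet.ncard * c ^ 2 * 2 ^ U.card + 1) := by
  obtain ⟨v⟩ := hG.nonempty
  rw [hus.length_eq, ← hes.length_eq]
  refine solveTime_le v.pos d.pos ((Finset.card_le_univ U).trans (by simp)) (fun h => ?_)
    fun h => ?_
  · have : Nontrivial (Fin n) := Fin.nontrivial_iff_two_le.2 h
    obtain ⟨w, hw⟩ := hG.preconnected.exists_adj_of_nontrivial v
    rcases (hes.adj_iff _ _).1 hw with h | h <;> exact List.length_pos_of_mem h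
  · subst h
    rw [List.length_eq_zero_iff, List.eq_nil_iff_forall_not_mem]
    rintro ⟨x, y⟩ he
    exact ((hes.adj_iff x y).2 (Or.inl he)).ne (Subsingleton.elim x y)

theorem length_instanceWords {n c : ℕ} (ω : Fin n → Fin c) (es : List (Fin n × Fin n))
    (us : List (Fin n)) :
    (instanceWords ω es us).length = 4 + c + n + 2 * es.length + us.length := by
  have := length_flatMap_pair (fun e : Fin n × Fin n => (e.1 : ℕ)) (fun e => (e.2 : ℕ)) es
  simp [instanceWords, this]
  ring

end Output

end FloodIt

theorem mainTheorem8 :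
    (∃ (p : FloodIt.RamProg) (K : ℕ),
      ∀ (n c k : ℕ) (G : SimpleGraph (Fin n)) (ω : Fin n → Fin c) (U : Finset (Fin n))
        (d : Fin c) (es : List (Fin n × Fin n)) (us : List (Fin n)),
        G.Connected → (∀ u v, G.Adj u v → ω u ≠ ω v) → U.card = k →
        FloodIt.ListsEdges G es → FloodIt.ListsVertices U us →
        ∃ r : ℕ, FloodIt.IsLinkNumberIn G ω (U : Set (Fin n)) d r ∧
          FloodIt.RamComputesWithin p ((d : ℕ) :: FloodIt.instanceWords ω es us) r
            (K * (n ^ (k + 3) * G.edgeSet.ncard * c ^ 2 * 2 ^ k + 1))) ∧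
    (∀ k : ℕ, ∃ (p : FloodIt.RamProg) (q : Polynomial ℕ),
      ∀ (n c : ℕ) (G : SimpleGraph (Fin n)) (ω : Fin n → Fin c) (U : Finset (Fin n))
        (es : List (Fin n × Fin n)) (us : List (Fin n)),
        G.Connected → U.card ≤ k →
        FloodIt.ListsEdges G es → FloodIt.ListsVertices U us →
        ∃ r : ℕ, FloodIt.IsLinkNumber G ω (U : Set (Fin n)) r ∧
          FloodIt.RamComputesWithin p (FloodIt.instanceWords ω es us) r
            (q.eval (FloodIt.instanceWords ω es us).length)) := by
  constructor
  -- 2000 for the table and 10 for the output, the latter absorbed by the summand 1.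
  · refine ⟨FloodIt.solveColour, 2010, fun n c k G ω U d es us hG _ hU hes hus => ?_⟩
    obtain ⟨v, hv, hrun⟩ := FloodIt.solveColour_runs (us := us) hG hes.adj_iff d
    refine ⟨_, hus.coe_eq ▸ hv.isLinkNumberIn, ?_⟩
    obtain ⟨t, s, ht, hex, hs⟩ := hrun
    refine ⟨t, s, ht.trans ?_, hex, hs⟩
    have := FloodIt.solveTime_le_of_lists hG d hes hus
    rw [hU] at this
    omega
  · intro k
    -- In the exponent `k + 6`, the vertices contribute `k + 3`, the edges 1 and the colours 2, all
    -- these counts being at most the input length; the linear term pays for the scan over the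
    -- colours.
    refine ⟨FloodIt.solveBest, Polynomial.C 2020 *
      (Polynomial.X ^ (k + 6) * Polynomial.C (2 ^ k) + 1) + Polynomial.C 20 * Polynomial.X,
      fun n c G ω U es us hG hU hes hus => ?_⟩
    obtain ⟨r, hr, t, s, ht, hex, hs⟩ :=
      FloodIt.solveBest_runs (ω := ω) (us := us) hG hes.adj_iff
    refine ⟨r, hus.coe_eq ▸ hr, t, s, ht.trans ?_, hex, hs⟩
    obtain ⟨v⟩ := hG.nonempty
    have h1 := FloodIt.solveTime_le_of_lists hG (ω v) hes hus
    have hL := FloodIt.length_instanceWords ω es us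
    simp only [Polynomial.eval_add, Polynomial.eval_mul, Polynomial.eval_pow, Polynomial.eval_X,
      Polynomial.eval_C, Polynomial.eval_one]
    rw [← hes.length_eq] at h1
    generalize (FloodIt.instanceWords ω es us).length = L at *
    have h2 : n ^ (U.card + 3) * es.length * c ^ 2 * 2 ^ U.card ≤ L ^ (k + 6) * 2 ^ k := by
      calc n ^ (U.card + 3) * es.length * c ^ 2 * 2 ^ U.card
          ≤ L ^ (k + 3) * L * L ^ 2 * 2 ^ k := by
            have e1 : n ^ (U.card + 3) ≤ L ^ (k + 3) :=
              (Nat.pow_le_pow_left (by omega) _).trans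
                (Nat.pow_le_pow_right (by omega) (by omega))
            have e2 : c ^ 2 ≤ L ^ 2 := Nat.pow_le_pow_left (by omega) _
            have e3 : 2 ^ U.card ≤ 2 ^ k := Nat.pow_le_pow_right (by omega) hU
            have e4 : es.length ≤ L := by omega
            gcongr
        _ = L ^ (k + 6) * 2 ^ k := by ring
    omega
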